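/- Let $V=\mathbb{Z}_+\times\mathbb{Z}$ and let $A=\{(\boldsymbol{x};d) : \boldsymbol{x}\in V,\ d\in\{0,1,2,3\}\}$ be the set of arcs, where $(\boldsymbol{x};d)$ has terminus $\boldsymbol{x}$ and origin $\boldsymbol{x}+(1,0)$ for $d=0$, $\boldsymbol{x}-(1,0)$ for $d=1$ (if $\boldsymbol{x}\notin\{0\}\times\mathbb{Z}$), $\boldsymbol{x}+(0,1)$ for $d=2$, $\boldsymbol{x}-(0,1)$ for $d=3$; for $\boldsymbol{x}\in\{0\}\times\mathbb{Z}$ the arc $(\boldsymbol{x};1)$ is a self-loop. Write $\bar a$ for the inverse arc of $a$ ($\bar a=a$ for self-loops), and $o(a)$, $t(a)$ for the origin and terminus. For $\alpha,\beta\in\mathbb{R}$ let $U$ be the operator on $\ell^2(A)$ given by $(U\psi)(a)=\sum_{b:\,t(b)=o(a)}\langle\delta_{\bar a},C_{o(a)}\delta_b\rangle\,\psi(b)$, with the local coins $$C_{\boldsymbol{x}}\delta_{(\boldsymbol{x};0)}=\cos\beta\,\delta_{(\boldsymbol{x};3)}+\sin\beta\,\delta_{(\boldsymbol{x};2)},\qquad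 C_{\boldsymbol{x}}\delta_{(\boldsymbol{x};1)}=-\sin\beta\,\delta_{(\boldsymbol{x};3)}+\cos\beta\,\delta_{(\boldsymbol{x};2)},$$ $$C_{\boldsymbol{x}}\delta_{(\boldsymbol{x};2)}=\cos\alpha\,\delta_{(\boldsymbol{x};1)}+\sin\alpha\,\delta_{(\boldsymbol{x};0)},\qquad C_{\boldsymbol{x}}\delta_{(\boldsymbol{x};3)}=-\sin\alpha\,\delta_{(\boldsymbol{x};1)}+\cos\alpha\,\delta_{(\boldsymbol{x};0)}.$$ Let $\psi_0=\delta_{((0,0);1)}$, $\psi_n=U^{2n}\psi_0$, and for $j\in\mathbb{Z}_+$, $m\in\mathbb{Z}$ put $\nu_n(2j,m)=|\psi_n((j,m);1)|^2$ and $\nu_n(2j+1,m)=|\psi_n((j,m);0)|^2$. Let $r=\sin(\alpha-\beta)$, $s=\sin(\alpha+\beta)$, and assume $0<|r|<1$ and $s\neq0$. Let $$f_K(y;p)=\frac{\sqrt{1-p^2}}{\pi(1-y^2)\sqrt{p^2-y^2}}\,\mathbf{1}_{(-p,p)}(y),\qquad \zeta(y)=\frac{|r|-|s||y|}{|r|+|s||y|},$$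 $$g(j,y)=\frac{2s^2}{r^2}\,y^2 f_K(y;|r|)\,\zeta(y)^{\lceil j/2\rceil}\times\begin{cases}\mathbf{1}_{[0,\infty)}(y)& sr>0,\\ \mathbf{1}_{(-\infty,0]}(y)& sr<0.\end{cases}$$ Then $g\ge 0$, each $g(j,\cdot)$ is integrable, and $\sum_{j\ge0}\int_{\mathbb{R}}g(j,y)\,dy\le1$, so $g$ is the density of a sub-probability measure on $\mathbb{Z}_+\times\mathbb{R}$. For every $j\in\mathbb{Z}_+$, as $n\to\infty$, the measures $\sum_m\nu_n(j,m)\,\delta_{m/n}$ converge weakly to $g(j,y)\,dy$: for all $a<b$, $$\lim_{n\to\infty}\ \sum_{a<m/n<b}\nu_n(j,m)=\int_a^b g(j,y)\,dy,$$ and $\lim_{n\to\infty}\sum_{m}\nu_n(j,m)f(m/n)=\int_{\mathbb{R}}f(y)g(j,y)\,dy$ for every bounded continuous $f:\mathbb{R}\to\mathbb{R}$. The limit decays exponentially into the bulk: $g(j,y)=\zeta(y)^{\lceil j/2\rceil}g(0,y)$, where $0<\zeta(y)<1$ for $0<|y|<|r|$. -/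

import Mathlib

open Filter Topology MeasureTheory Set
open scoped BoundedContinuousFunction

noncomputable section

namespace AEModel

/-- The vertex set `ℤ₊ × ℤ` of the half plane. -/
abbrev Vertex : Type := ℕ × ℤ

/-- The arc set: `(x, d)` is the arc with terminus `x` coming from direction `d`
(`0` right, `1` left, `2` up, `3` down); on the boundary `{0} × ℤ` the arc of
direction `1` is a self-loop. -/
abbrev Arc : Type := Vertex × Fin 4

/-- The terminus of an arc. -/
def terminus (a : Arc) : Vertex := a.1

/-- The origin of an arc. -/
def origin : Arc → Vertex
  | ((x, y), 0) => (x + 1, y)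
  | ((0, y), 1) => (0, y)
  | ((x + 1, y), 1) => (x, y)
  | ((x, y), 2) => (x, y + 1)
  | ((x, y), 3) => (x, y - 1)

/-- The inverse arc; a self-loop is its own inverse. -/
def inv : Arc → Arc
  | ((x, y), 0) => ((x + 1, y), 1)
  | ((0, y), 1) => ((0, y), 1)
  | ((x + 1, y), 1) => ((x, y), 0)
  | ((x, y), 2) => ((x, y + 1), 3)
  | ((x, y), 3) => ((x, y - 1), 2)

theorem inv_inv (a : Arc) : inv (inv a) = a := by
  obtain ⟨⟨x, y⟩, d⟩ := a
  fin_cases d <;> cases x <;> simp [inv]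

theorem terminus_inv (a : Arc) : terminus (inv a) = origin a := by
  obtain ⟨⟨x, y⟩, d⟩ := a
  fin_cases d <;> cases x <;> simp [inv, origin, terminus]

/-- The matrix of the local coin `C_x` in the basis `δ_(x;0), …, δ_(x;3)`:
`coin α β d' d = ⟨δ_(x;d'), C_x δ_(x;d)⟩`, that is,
`C δ₀ = cos β δ₃ + sin β δ₂`, `C δ₁ = - sin β δ₃ + cos β δ₂`,
`C δ₂ = cos α δ₁ + sin α δ₀`, `C δ₃ = - sin α δ₁ + cos α δ₀`. -/
def coin (α β : ℝ) : Matrix (Fin 4) (Fin 4) ℝ :=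
  !![0, 0, Real.sin α, Real.cos α;
     0, 0, Real.cos α, -Real.sin α;
     Real.sin β, Real.cos β, 0, 0;
     Real.cos β, -Real.sin β, 0, 0]

/-- One step of the walk on amplitudes:
`(U ψ)(a) = ∑_{b : t(b) = o(a)} ⟨δ_(inv a), C_{o(a)} δ_b⟩ ψ(b)`;
the arcs `b` with terminus `o(a)` are the `(o(a); d)`, and `inv a` is one of them. -/
def stepFun (α β : ℝ) (ψ : Arc → ℂ) (a : Arc) : ℂ :=
  ∑ d : Fin 4, (coin α β (inv a).2 d : ℂ) * ψ (origin a, d)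

theorem abs_coin_le (α β : ℝ) (i j : Fin 4) : |coin α β i j| ≤ 1 := by
  fin_cases i <;> fin_cases j <;>
    simp [coin, Real.abs_sin_le_one, Real.abs_cos_le_one]

/-- The step preserves square-summability. -/
theorem memlp_stepFun (α β : ℝ) {ψ : Arc → ℂ} (hψ : Memℓp ψ 2) :
    Memℓp (stepFun α β ψ) 2 := by
  have hs : Summable fun a : Arc => ‖ψ a‖ ^ (2 : ℝ) := by
    simpa using (memℓp_gen_iff (p := 2) (by norm_num)).1 hψ
  have hinj : Function.Injective inv := Function.LeftInverse.injective inv_inv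
  -- each summand is square-summable
  have key : ∀ d : Fin 4,
      Memℓp (fun a : Arc => (coin α β (inv a).2 d : ℂ) * ψ (origin a, d)) 2 := by
    intro d
    have h1 : Summable fun a : Arc => ‖ψ (a.1, d)‖ ^ (2 : ℝ) := by
      have hv : Summable fun v : Vertex => ‖ψ (v, d)‖ ^ (2 : ℝ) :=
        hs.comp_injective (i := fun v : Vertex => ((v, d) : Arc))
          (fun v w h => (Prod.mk.inj h).1)
      have := hv.mul_of_nonneg
        (Summable.of_finite : Summable fun _ : Fin 4 => (1 : ℝ))
        (fun v => by positivity) (fun _ => zero_le_one)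
      simpa using this
    have h2 : Summable fun a : Arc => ‖ψ (origin a, d)‖ ^ (2 : ℝ) := by
      have := h1.comp_injective hinj
      refine this.congr fun a => ?_
      have : (inv a).1 = origin a := terminus_inv a
      simp [this]
    rw [memℓp_gen_iff (by norm_num)]
    refine Summable.of_nonneg_of_le (fun a => by positivity) (fun a => ?_) (by simpa using h2)
    have hc : ‖(coin α β (inv a).2 d : ℂ)‖ ≤ 1 := by
      simpa using abs_coin_le α β (inv a).2 d
    have : ‖(coin α β (inv a).2 d : ℂ) * ψ (origin a, d)‖ ≤ ‖ψ (origin a, d)‖ := by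
      rw [norm_mul]
      exact mul_le_of_le_one_left (norm_nonneg _) hc
    simpa using pow_le_pow_left₀ (norm_nonneg _) this 2
  exact Memℓp.finsetSum Finset.univ (fun d _ => key d)

/-- The Hilbert space `ℓ²(A)`. -/
abbrev Hilb : Type := lp (fun _ : Arc => ℂ) 2

/-- The time evolution `U` on `ℓ²(A)`. -/
def U (α β : ℝ) : Hilb →ₗ[ℂ] Hilb where
  toFun ψ := ⟨stepFun α β ψ, memlp_stepFun α β (lp.memℓp ψ)⟩
  map_add' ψ φ := by
    ext a
    change stepFun α β (ψ + φ : Hilb) a = stepFun α β ψ a + stepFun α β φ a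
    simp [stepFun, mul_add, Finset.sum_add_distrib]
  map_smul' c ψ := by
    ext a
    change stepFun α β (c • ψ : Hilb) a = c * stepFun α β ψ a
    simp [stepFun, Finset.mul_sum, mul_left_comm]

/-- The initial state: the Kronecker delta at the self-loop at the origin. -/
def psi0 : Hilb := lp.single 2 (((0, 0), 1) : Arc) (1 : ℂ)

/-- The state `ψ_n = U^(2n) ψ_0`. -/
def psi (α β : ℝ) (n : ℕ) : Hilb := ((U α β) ^ (2 * n)) psi0

/-- The finding probabilities on the horizontal arcs:
`ν_n(2j, m) = |ψ_n((j,m);1)|²` and `ν_n(2j+1, m) = |ψ_n((j,m);0)|²`. -/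
def nu (α β : ℝ) (n j : ℕ) (m : ℤ) : ℝ :=
  ‖psi α β n ((j / 2, m), if Even j then 1 else 0)‖ ^ 2

/-- The density of the Konno distribution with parameter `p`. -/
def konnoDensity (x p : ℝ) : ℝ :=
  (Ioo (-p) p).indicator
    (fun x => √(1 - p ^ 2) / (Real.pi * (1 - x ^ 2) * √(p ^ 2 - x ^ 2))) x

/-- The decay factor `ζ(y)`. -/
def zeta (r s y : ℝ) : ℝ := (|r| - |s| * |y|) / (|r| + |s| * |y|)

/-- The half line on which the limit density lives. -/
def halfLine (r s : ℝ) : Set ℝ :=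
  {y | (0 < s * r ∧ 0 ≤ y) ∨ (s * r < 0 ∧ y ≤ 0)}

/-- The limit density `g(j, y)`. -/
def g (r s : ℝ) (j : ℕ) (y : ℝ) : ℝ :=
  (halfLine r s).indicator
    (fun y => 2 * s ^ 2 / r ^ 2 * y ^ 2 * konnoDensity y |r| * zeta r s y ^ ⌈(j : ℝ) / 2⌉₊) y

end AEModel

end

/-! The square of `U` maps horizontal arcs to horizontal arcs and commutes with vertical
translations. A Fourier transform in m therefore turns it, at each momentum k, into a coined walk on
the half line with constant coin entries A(k), B(k), |A|² + |B|² = 1, started at the boundary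
(`hasSum_psi`).

For sin k, cos k ≠ 0 the fixed-momentum walk has an eigenvector localised at the boundary, and at
every fixed site only the part of the initial state along it survives (`tendsto_halfLineWalk`). The
proof goes through generating functions. That of the boundary amplitude is a quotient: the numerator
contains a square root and has absolutely summable Taylor coefficients, the denominator is a
quadratic with two simple zeros on the unit circle. Asymptotically only these poles count
(`tendsto_coeff_mul_geom`), and the numerator vanishes at one of them. What remains is q λⁿ, with λ
= `edgePhase` and q = `edgeWeight` (`tendsto_boundary`). The recursion carries this limit into the
bulk, with a factor `edgeDecay` per site.

By Parseval, the characteristic function of m/n under ν_n(j, ·) at t is (2π)⁻¹ ∫ conj f_n(k) f_n(k +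
t/n) dk, where f_n is the amplitude at momentum k. Replacing f_n by its edge part costs o(1) by
dominated convergence. In the edge part, (conj λ(k) λ(k + t/n))ⁿ → exp(i t v(k)), because λ' = i v λ
(`hasDerivAt_edgePhase`). So the limit is the image of the momentum density `edgeProb` under the
group velocity v. Since v has the sign of sr throughout, only one half line is charged. The
substitution y = v(k) turns this image into g(j, y) dy (`abs_deriv_mul_g_edgeVel`,
`integral_g_smul_eq_circle`).

Mass is lost to the dispersive part, so an atom is added to make both sides probability measures
before Lévy's continuity theorem is applied (`tendsto_walkLaw`). The total mass is at most one
because `edgeProb` sums over j to q ≤ 1 at each momentum. -/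

noncomputable section

namespace AEModel

/-! ### The half-line walk and its energy bound -/

/-- A coined walk on the half line with constant coin `[[A, B], [-B̄, Ā]]`, started from the
right-moving state at the boundary: the pairs are the left- and the right-moving amplitude. -/
def halfLineWalk (A B : ℂ) : ℕ → ℕ → ℂ × ℂ
  | 0, 0 => (0, 1)
  | 0, _ + 1 => (0, 0)
  | n + 1, 0 =>
    (A * (halfLineWalk A B n 1).1 + B * (halfLineWalk A B n 1).2,
      A * (halfLineWalk A B n 0).1 + B * (halfLineWalk A B n 0).2)
  | n + 1, j + 1 =>
    (A * (halfLineWalk A B n (j + 2)).1 + B * (halfLineWalk A B n (j + 2)).2,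
      -star B * (halfLineWalk A B n j).1 + star A * (halfLineWalk A B n j).2)

theorem halfLineWalk_succ_fst (A B : ℂ) (n j : ℕ) :
    (halfLineWalk A B (n + 1) j).1 =
      A * (halfLineWalk A B n (j + 1)).1 + B * (halfLineWalk A B n (j + 1)).2 := by
  cases j <;> simp [halfLineWalk]

theorem halfLineWalk_succ_snd_zero (A B : ℂ) (n : ℕ) :
    (halfLineWalk A B (n + 1) 0).2 =
      A * (halfLineWalk A B n 0).1 + B * (halfLineWalk A B n 0).2 := by
  simp [halfLineWalk]

theorem halfLineWalk_succ_snd_succ (A B : ℂ) (n j : ℕ) :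
    (halfLineWalk A B (n + 1) (j + 1)).2 =
      -star B * (halfLineWalk A B n j).1 + star A * (halfLineWalk A B n j).2 := by
  simp [halfLineWalk]

theorem halfLineWalk_zero_fst (A B : ℂ) (j : ℕ) : (halfLineWalk A B 0 j).1 = 0 := by
  cases j <;> simp [halfLineWalk]

theorem normSq_coin_add {A B : ℂ} (h : Complex.normSq A + Complex.normSq B = 1) (u w : ℂ) :
    Complex.normSq (A * u + B * w) + Complex.normSq (-star B * u + star A * w) =
      Complex.normSq u + Complex.normSq w := by
  have : Complex.normSq (A * u + B * w) + Complex.normSq (-star B * u + star A * w) =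
      (Complex.normSq A + Complex.normSq B) * (Complex.normSq u + Complex.normSq w) := by
    simp [Complex.normSq_apply]
    ring
  rw [this, h, one_mul]

/-- The energy of the half-line walk in a finite window is at most one. -/
theorem sum_normSq_halfLineWalk_le {A B : ℂ} (h : Complex.normSq A + Complex.normSq B = 1)
    (n N : ℕ) :
    ∑ j ∈ Finset.range N, (Complex.normSq (halfLineWalk A B n j).1 +
      Complex.normSq (halfLineWalk A B n j).2) ≤ 1 := by
  induction n generalizing N with
  | zero =>
    cases N with
    | zero => simp
    | succ N =>
      rw [Finset.sum_range_succ']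
      simp [halfLineWalk]
  | succ n ih =>
    cases N with
    | zero => simp
    | succ N =>
      -- Sites 0, …, N at the new time are fed only by sites 0, …, N + 1 at the old time. The two
      -- right-moving outputs that leave the window are dropped at the end.
      refine le_trans ?_ (ih (N + 2))
      rw [Finset.sum_add_distrib, Finset.sum_range_succ' (fun j =>
        Complex.normSq (halfLineWalk A B (n + 1) j).2)]
      simp only [halfLineWalk_succ_fst, halfLineWalk_succ_snd_zero, halfLineWalk_succ_snd_succ]
      have e : ∀ j, Complex.normSq (halfLineWalk A B n j).1 +
          Complex.normSq (halfLineWalk A B n j).2 =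
          Complex.normSq (A * (halfLineWalk A B n j).1 + B * (halfLineWalk A B n j).2) +
          Complex.normSq (-star B * (halfLineWalk A B n j).1 +
            star A * (halfLineWalk A B n j).2) := fun j => (normSq_coin_add h _ _).symm
      simp only [e]
      rw [Finset.sum_add_distrib, Finset.sum_range_succ' (fun j => Complex.normSq
        (A * (halfLineWalk A B n j).1 + B * (halfLineWalk A B n j).2)), Finset.sum_range_succ
        (fun j => Complex.normSq (-star B * (halfLineWalk A B n j).1 +
            star A * (halfLineWalk A B n j).2)), Finset.sum_range_succ
        (fun j => Complex.normSq (-star B * (halfLineWalk A B n j).1 +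
            star A * (halfLineWalk A B n j).2))]
      have h1 := Complex.normSq_nonneg (-star B * (halfLineWalk A B n N).1 +
            star A * (halfLineWalk A B n N).2)
      have h2 := Complex.normSq_nonneg (-star B * (halfLineWalk A B n (N + 1)).1 +
            star A * (halfLineWalk A B n (N + 1)).2)
      linarith

theorem normSq_halfLineWalk_le {A B : ℂ} (h : Complex.normSq A + Complex.normSq B = 1)
    (n j : ℕ) : Complex.normSq (halfLineWalk A B n j).1 +
      Complex.normSq (halfLineWalk A B n j).2 ≤ 1 :=
  (Finset.single_le_sum (f := fun j => Complex.normSq (halfLineWalk A B n j).1 +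
      Complex.normSq (halfLineWalk A B n j).2)
    (fun _ _ => add_nonneg (Complex.normSq_nonneg _) (Complex.normSq_nonneg _))
    (Finset.self_mem_range_succ j)).trans (sum_normSq_halfLineWalk_le h n (j + 1))

theorem norm_halfLineWalk_fst_le {A B : ℂ} (h : Complex.normSq A + Complex.normSq B = 1)
    (n j : ℕ) : ‖(halfLineWalk A B n j).1‖ ≤ 1 := by
  have := normSq_halfLineWalk_le h n j
  rw [Complex.normSq_eq_norm_sq, Complex.normSq_eq_norm_sq] at this
  exact abs_le_one_iff_mul_self_le_one.2 (by nlinarith [sq_nonneg ‖(halfLineWalk A B n j).2‖])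
    |> (le_abs_self _).trans

theorem norm_halfLineWalk_snd_le {A B : ℂ} (h : Complex.normSq A + Complex.normSq B = 1)
    (n j : ℕ) : ‖(halfLineWalk A B n j).2‖ ≤ 1 := by
  have := normSq_halfLineWalk_le h n j
  rw [Complex.normSq_eq_norm_sq, Complex.normSq_eq_norm_sq] at this
  exact abs_le_one_iff_mul_self_le_one.2 (by nlinarith [sq_nonneg ‖(halfLineWalk A B n j).1‖])
    |> (le_abs_self _).trans

/-! ### The two-step walk on the horizontal arcs -/

theorem psi_succ_apply (α β : ℝ) (n : ℕ) (a : Arc) :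
    psi α β (n + 1) a = stepFun α β (stepFun α β (psi α β n)) a := by
  have : psi α β (n + 1) = U α β (U α β (psi α β n)) := by
    simp only [psi, show 2 * (n + 1) = 2 * n + 1 + 1 by ring, pow_succ', Module.End.mul_apply]
  rw [this]
  rfl

theorem psi_succ_fst (α β : ℝ) (n j : ℕ) (m : ℤ) :
    psi α β (n + 1) ((j, m), 0) =
      Real.cos α * (Real.cos β * psi α β n ((j + 1, m + 1), 0)
        - Real.sin β * psi α β n ((j + 1, m + 1), 1))
      - Real.sin α * (Real.sin β * psi α β n ((j + 1, m - 1), 0)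
        + Real.cos β * psi α β n ((j + 1, m - 1), 1)) := by
  rw [psi_succ_apply]
  simp [stepFun, Fin.sum_univ_four, coin, inv, origin]
  ring

theorem psi_succ_snd_zero (α β : ℝ) (n : ℕ) (m : ℤ) :
    psi α β (n + 1) ((0, m), 1) =
      Real.cos α * (Real.cos β * psi α β n ((0, m + 1), 0)
        - Real.sin β * psi α β n ((0, m + 1), 1))
      - Real.sin α * (Real.sin β * psi α β n ((0, m - 1), 0)
        + Real.cos β * psi α β n ((0, m - 1), 1)) := by
  rw [psi_succ_apply]
  simp only [stepFun, Fin.sum_univ_four, coin, inv, origin]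
  simp
  ring

theorem psi_succ_snd_succ (α β : ℝ) (n j : ℕ) (m : ℤ) :
    psi α β (n + 1) ((j + 1, m), 1) =
      Real.sin α * (Real.cos β * psi α β n ((j, m + 1), 0)
        - Real.sin β * psi α β n ((j, m + 1), 1))
      + Real.cos α * (Real.sin β * psi α β n ((j, m - 1), 0)
        + Real.cos β * psi α β n ((j, m - 1), 1)) := by
  rw [psi_succ_apply]
  simp [stepFun, Fin.sum_univ_four, coin, inv, origin]
  ring_nf
  simp

theorem psi_zero_fst (α β : ℝ) (j : ℕ) (m : ℤ) : psi α β 0 ((j, m), 0) = 0 := by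
  simp [psi, psi0, lp.single_apply]

theorem psi_zero_snd (α β : ℝ) (j : ℕ) (m : ℤ) :
    psi α β 0 ((j, m), 1) = if j = 0 ∧ m = 0 then 1 else 0 := by
  simp [psi, psi0, lp.single_apply, Pi.single_apply]

/-- The diagonal coin entry of the walk at vertical momentum `k`, where `z = exp (i k)`. -/
def coinA (α β : ℝ) (z : ℂ) : ℂ :=
  Real.cos α * Real.cos β * z⁻¹ - Real.sin α * Real.sin β * z

/-- The off-diagonal coin entry of the walk at vertical momentum `k`, where `z = exp (i k)`. -/
def coinB (α β : ℝ) (z : ℂ) : ℂ :=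
  -(Real.cos α * Real.sin β * z⁻¹ + Real.sin α * Real.cos β * z)

theorem hasSum_shift {c : ℤ → ℂ} {z v : ℂ} (hz : z ≠ 0) (d : ℤ)
    (h : HasSum (fun m => c m * z ^ m) v) :
    HasSum (fun m => c (m + d) * z ^ m) (z ^ (-d) * v) := by
  have := ((Equiv.addRight d).hasSum_iff.2 h).mul_left (z ^ (-d))
  refine this.congr_fun ?_
  intro m
  simp [zpow_add₀ hz, zpow_neg]
  field_simp

/-- The vertical shifts by ±1 become the factors z⁻¹ and z, which turns the two-step recursion into
that of the half-line walk. The condition ‖z‖ = 1 enters through star z = z⁻¹, which identifies the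
coefficients of the right-moving recursion with star A and -star B. -/
theorem hasSum_psi (α β : ℝ) {z : ℂ} (hz : ‖z‖ = 1) (n j : ℕ) :
    HasSum (fun m : ℤ => psi α β n ((j, m), 0) * z ^ m)
      (halfLineWalk (coinA α β z) (coinB α β z) n j).1 ∧
    HasSum (fun m : ℤ => psi α β n ((j, m), 1) * z ^ m)
      (halfLineWalk (coinA α β z) (coinB α β z) n j).2 := by
  have hz0 : z ≠ 0 := by
    rintro rfl
    simp at hz
  have hstar : star z = z⁻¹ := by
    rw [Complex.inv_def, Complex.normSq_eq_norm_sq, hz]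
    simp
  have hstarA : star (coinA α β z) =
      Real.cos α * Real.cos β * z - Real.sin α * Real.sin β * z⁻¹ := by
    simp only [coinA, star_sub, star_mul', star_inv₀, hstar, _root_.inv_inv]
    simp only [Complex.star_def, Complex.conj_ofReal]
  have hstarB : star (coinB α β z) =
      -(Real.cos α * Real.sin β * z + Real.sin α * Real.cos β * z⁻¹) := by
    simp only [coinB, star_neg, star_add, star_mul', star_inv₀, hstar, _root_.inv_inv]
    simp only [Complex.star_def, Complex.conj_ofReal]
  induction n generalizing j with
  | zero =>
    constructor
    · simp [psi_zero_fst, halfLineWalk_zero_fst, hasSum_zero]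
    · have : (halfLineWalk (coinA α β z) (coinB α β z) 0 j).2 =
          psi α β 0 ((j, 0), 1) * z ^ (0 : ℤ) := by
        cases j <;> simp [psi_zero_snd, halfLineWalk]
      rw [this]
      refine hasSum_single 0 fun m hm => ?_
      simp [psi_zero_snd, hm]
  | succ n ih =>
    have key : ∀ (i : ℕ) (a b c d : ℂ),
        HasSum (fun m : ℤ => (a * (b * psi α β n ((i, m + 1), 0)
          - c * psi α β n ((i, m + 1), 1))
          + d * (c * psi α β n ((i, m - 1), 0)
          + b * psi α β n ((i, m - 1), 1))) * z ^ m)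
          (a * (b * (z⁻¹ * (halfLineWalk (coinA α β z) (coinB α β z) n i).1)
            - c * (z⁻¹ * (halfLineWalk (coinA α β z) (coinB α β z) n i).2))
          + d * (c * (z * (halfLineWalk (coinA α β z) (coinB α β z) n i).1)
            + b * (z * (halfLineWalk (coinA α β z) (coinB α β z) n i).2))) := by
      intro i a b c d
      have f1 := hasSum_shift hz0 1 (ih i).1
      have f2 := hasSum_shift hz0 1 (ih i).2
      have f3 := hasSum_shift hz0 (-1) (ih i).1
      have f4 := hasSum_shift hz0 (-1) (ih i).2
      simp only [neg_neg, zpow_one, zpow_neg, ← sub_eq_add_neg] at f1 f2 f3 f4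
      refine (((f1.mul_left b).sub (f2.mul_left c)).mul_left a |>.add
        (((f3.mul_left c).add (f4.mul_left b)).mul_left d)).congr_fun ?_
      intro m
      ring
    constructor
    · have := key (j + 1) (Real.cos α) (Real.cos β) (Real.sin β) (-Real.sin α)
      rw [halfLineWalk_succ_fst]
      convert! this using 1
      · funext m
        rw [psi_succ_fst]
        ring
      · simp only [coinA, coinB]
        ring
    · cases j with
      | zero =>
        have := key 0 (Real.cos α) (Real.cos β) (Real.sin β) (-Real.sin α)
        rw [halfLineWalk_succ_snd_zero]
        convert! this using 1
        · funext m
          rw [psi_succ_snd_zero]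
          ring
        · simp only [coinA, coinB]
          ring
      | succ j =>
        have := key j (Real.sin α) (Real.cos β) (Real.sin β) (Real.cos α)
        rw [halfLineWalk_succ_snd_succ, hstarA, hstarB]
        convert! this using 1
        · funext m
          rw [psi_succ_snd_succ]
        · ring

/-- Finite propagation speed: two steps of `U` change the height by one. All vertical Fourier series
are therefore trigonometric polynomials, and Fourier inversion raises no convergence question. -/
theorem psi_eq_zero (α β : ℝ) (n j : ℕ) (m : ℤ) (hm : (n : ℤ) < |m|) :
    psi α β n ((j, m), 0) = 0 ∧ psi α β n ((j, m), 1) = 0 := by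
  induction n generalizing j m with
  | zero =>
    have : m ≠ 0 := by
      rintro rfl
      simp at hm
    simp [psi_zero_fst, psi_zero_snd, this]
  | succ n ih =>
    have h1 : (n : ℤ) < |m + 1| := by
      push_cast at hm
      have := abs_sub (m + 1) 1
      simp at this
      linarith
    have h2 : (n : ℤ) < |m - 1| := by
      push_cast at hm
      have := abs_add_le (m - 1) 1
      simp at this
      linarith
    refine ⟨?_, ?_⟩
    · simp [psi_succ_fst, ih _ _ h1, ih _ _ h2]
    · cases j with
      | zero => simp [psi_succ_snd_zero, ih _ _ h1, ih _ _ h2]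
      | succ j => simp [psi_succ_snd_succ, ih _ _ h1, ih _ _ h2]

/-! ### Power series with absolutely summable coefficients -/

/-- The coefficients of a power series are absolutely summable. -/
def AbsSummable (P : PowerSeries ℂ) : Prop := Summable fun n => ‖PowerSeries.coeff n P‖

/-- The value of a power series at a point. -/
def psEval (P : PowerSeries ℂ) (z : ℂ) : ℂ := ∑' n, PowerSeries.coeff n P * z ^ n

theorem AbsSummable.summable_norm {P : PowerSeries ℂ} (hP : AbsSummable P) {z : ℂ}
    (hz : ‖z‖ ≤ 1) : Summable fun n => ‖PowerSeries.coeff n P * z ^ n‖ :=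
  Summable.of_nonneg_of_le (fun _ => norm_nonneg _) (fun n => by
    rw [norm_mul, norm_pow]
    exact mul_le_of_le_one_right (norm_nonneg _) (pow_le_one₀ (norm_nonneg _) hz)) hP

theorem AbsSummable.add {P Q : PowerSeries ℂ} (hP : AbsSummable P) (hQ : AbsSummable Q) :
    AbsSummable (P + Q) :=
  Summable.of_nonneg_of_le (fun _ => norm_nonneg _)
    (fun n => by simpa using norm_add_le _ _) (Summable.add hP hQ)

theorem coeff_mul_mul_pow (P Q : PowerSeries ℂ) (z : ℂ) (n : ℕ) :
    PowerSeries.coeff n (P * Q) * z ^ n = ∑ kl ∈ Finset.HasAntidiagonal.antidiagonal n,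
      (PowerSeries.coeff kl.1 P * z ^ kl.1) * (PowerSeries.coeff kl.2 Q * z ^ kl.2) := by
  rw [PowerSeries.coeff_mul, Finset.sum_mul]
  refine Finset.sum_congr rfl fun kl hkl => ?_
  rw [← Finset.HasAntidiagonal.mem_antidiagonal.1 hkl, pow_add]
  ring

theorem AbsSummable.mul {P Q : PowerSeries ℂ} (hP : AbsSummable P) (hQ : AbsSummable Q) :
    AbsSummable (P * Q) := by
  have := summable_norm_sum_mul_antidiagonal_of_summable_norm hP hQ
  refine this.congr fun n => ?_
  rw [PowerSeries.coeff_mul]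

theorem AbsSummable.polynomial (p : Polynomial ℂ) : AbsSummable (p : PowerSeries ℂ) := by
  refine summable_of_ne_finset_zero (s := p.support) fun n hn => ?_
  simpa using hn

theorem AbsSummable.rescale {P : PowerSeries ℂ} (hP : AbsSummable P) {c : ℂ} (hc : ‖c‖ ≤ 1) :
    AbsSummable (PowerSeries.rescale c P) := by
  refine (hP.summable_norm hc).congr fun n => ?_
  rw [PowerSeries.coeff_rescale, mul_comm]

theorem psEval_add {P Q : PowerSeries ℂ} (hP : AbsSummable P) (hQ : AbsSummable Q) {z : ℂ}
    (hz : ‖z‖ ≤ 1) : psEval (P + Q) z = psEval P z + psEval Q z := by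
  unfold psEval
  rw [← (hP.summable_norm hz).of_norm.tsum_add (hQ.summable_norm hz).of_norm]
  simp [add_mul]

theorem psEval_mul {P Q : PowerSeries ℂ} (hP : AbsSummable P) (hQ : AbsSummable Q) {z : ℂ}
    (hz : ‖z‖ ≤ 1) : psEval (P * Q) z = psEval P z * psEval Q z := by
  unfold psEval
  rw [tsum_mul_tsum_eq_tsum_sum_antidiagonal_of_summable_norm (hP.summable_norm hz)
    (hQ.summable_norm hz)]
  exact tsum_congr (coeff_mul_mul_pow P Q z)

theorem psEval_polynomial (p : Polynomial ℂ) (z : ℂ) :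
    psEval (p : PowerSeries ℂ) z = p.eval z := by
  unfold psEval
  rw [tsum_eq_sum (s := p.support) (fun n hn => by
    rw [Polynomial.coeff_coe, Polynomial.notMem_support_iff.1 hn, zero_mul])]
  simp [Polynomial.eval_eq_sum, Polynomial.sum]

theorem psEval_rescale (P : PowerSeries ℂ) (c z : ℂ) :
    psEval (PowerSeries.rescale c P) z = psEval P (c * z) := by
  unfold psEval
  refine tsum_congr fun n => ?_
  rw [PowerSeries.coeff_rescale, mul_pow]
  ring

/-- Dividing by `1 - λ X` with `‖λ‖ = 1`: the coefficients are asymptotic to a multiple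
of `λ ^ n`. -/
theorem tendsto_coeff_mul_geom {N : PowerSeries ℂ} (hN : AbsSummable N) {l : ℂ} (hl : ‖l‖ = 1) :
    Tendsto (fun n => PowerSeries.coeff n (PowerSeries.mk (fun n => l ^ n) * N)
      - l ^ n * psEval N (star l)) atTop (𝓝 0) := by
  have hl' : l * star l = 1 := by
    rw [Complex.star_def, Complex.mul_conj, Complex.normSq_eq_norm_sq, hl]
    simp
  have hz : ‖star l‖ ≤ 1 := by rw [norm_star, hl]
  have h := ((hN.summable_norm hz).of_norm.hasSum.tendsto_sum_nat.comp
    (tendsto_add_atTop_nat 1)).sub_const (psEval N (star l))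
  rw [psEval, sub_self] at h
  rw [tendsto_zero_iff_norm_tendsto_zero] at h ⊢
  refine h.congr fun n => ?_
  -- As l has modulus one, l ^ (n - i) = l ^ n (star l) ^ i. The coefficient is l ^ n times a
  -- partial sum of the series for N at star l, and the error is a tail of that series.
  have e : PowerSeries.coeff n (PowerSeries.mk (fun n => l ^ n) * N) =
      l ^ n * ∑ i ∈ Finset.range (n + 1), PowerSeries.coeff i N * star l ^ i := by
    rw [mul_comm, PowerSeries.coeff_mul, Finset.Nat.sum_antidiagonal_eq_sum_range_succ_mk,
      Finset.mul_sum]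
    refine Finset.sum_congr rfl fun i hi => ?_
    have hi' : i ≤ n := Nat.lt_succ_iff.1 (Finset.mem_range.1 hi)
    obtain ⟨d, rfl⟩ := Nat.exists_eq_add_of_le hi'
    have : l ^ i * star l ^ i = 1 := by rw [← mul_pow, hl', one_pow]
    simp only [PowerSeries.coeff_mk, Nat.add_sub_cancel_left, pow_add]
    linear_combination (-PowerSeries.coeff i N * l ^ d) * this
  rw [e, ← mul_sub, norm_mul, norm_pow, hl, one_pow, one_mul]
  rfl

/-! ### The square root series -/

/-- The Taylor series of `√(1 - u)` at `u = 0`. -/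
def sqrtSeries : PowerSeries ℂ :=
  1 - 2 * (PowerSeries.X * PowerSeries.mk fun n => (catalan n : ℂ) / 4 ^ (n + 1))

/-- This is the quadratic equation of the Catalan generating function, rescaled by 1/4, with the
square completed. -/
theorem sqrtSeries_mul_self : sqrtSeries * sqrtSeries = 1 - PowerSeries.X := by
  set c : PowerSeries ℂ := PowerSeries.rescale (1 / 4 : ℂ)
    (PowerSeries.map (Nat.castRingHom ℂ) PowerSeries.catalanSeries) with hc
  have h4 : (4 : PowerSeries ℂ) * PowerSeries.C (1 / 4 : ℂ) = 1 := by
    rw [show (4 : PowerSeries ℂ) = PowerSeries.C (4 : ℂ) from (map_ofNat PowerSeries.C 4).symm, ← map_mul]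
    norm_num
  have h1 : (PowerSeries.mk fun n => (catalan n : ℂ) / 4 ^ (n + 1)) =
      PowerSeries.C (1 / 4 : ℂ) * c := by
    ext n
    simp [hc, PowerSeries.coeff_C_mul, PowerSeries.coeff_rescale, pow_succ]
    ring
  have h2 : c ^ 2 * (PowerSeries.C (1 / 4 : ℂ) * PowerSeries.X) + 1 = c := by
    have := congrArg (fun P => PowerSeries.rescale (1 / 4 : ℂ)
      (PowerSeries.map (Nat.castRingHom ℂ) P)) PowerSeries.catalanSeries_sq_mul_X_add_one
    simpa [hc, PowerSeries.rescale_X] using this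
  rw [sqrtSeries, h1]
  linear_combination (4 * PowerSeries.X * PowerSeries.C (1 / 4 : ℂ)) * h2 -
    PowerSeries.X * h4

/-- The sum telescopes through the recursion for central binomial coefficients. Since √(1 - u) is
one minus a series with these nonnegative coefficients of total at most one, the formula yields both
absolute summability and a nonnegative real part on the closed disc. -/
theorem sum_catalan_div (N : ℕ) :
    ∑ n ∈ Finset.range N, 2 * ((catalan n : ℝ) / 4 ^ (n + 1)) =
      1 - (Nat.centralBinom N : ℝ) / 4 ^ N := by
  induction N with
  | zero => simp
  | succ N ih =>
    rw [Finset.sum_range_succ, ih]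
    have h1 : ((N : ℝ) + 1) * catalan N = Nat.centralBinom N := by
      exact_mod_cast succ_mul_catalan_eq_centralBinom N
    have h2 : ((N : ℝ) + 1) * Nat.centralBinom (N + 1) =
        2 * (2 * N + 1) * Nat.centralBinom N := by
      exact_mod_cast Nat.succ_mul_centralBinom_succ N
    have hN : (N : ℝ) + 1 ≠ 0 := by positivity
    have h3 : (catalan N : ℝ) = Nat.centralBinom N / (N + 1) := by
      rw [← h1]; field_simp
    have h4 : (Nat.centralBinom (N + 1) : ℝ) = 2 * (2 * N + 1) * Nat.centralBinom N / (N + 1) := by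
      rw [← h2]; field_simp
    rw [h3, h4, pow_succ]
    field_simp
    ring

theorem sum_catalan_div_le (N : ℕ) :
    ∑ n ∈ Finset.range N, 2 * ((catalan n : ℝ) / 4 ^ (n + 1)) ≤ 1 := by
  rw [sum_catalan_div]
  have : (0 : ℝ) ≤ (Nat.centralBinom N : ℝ) / 4 ^ N := by positivity
  linarith

theorem summable_catalan_div : Summable fun n => 2 * ((catalan n : ℝ) / 4 ^ (n + 1)) :=
  summable_of_sum_range_le (fun _ => by positivity) sum_catalan_div_le

theorem coeff_sqrtSeries_succ (n : ℕ) : PowerSeries.coeff (n + 1) sqrtSeries =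
    -((2 * ((catalan n : ℝ) / 4 ^ (n + 1)) : ℝ) : ℂ) := by
  rw [sqrtSeries, show (2 : PowerSeries ℂ) = PowerSeries.C (2 : ℂ) from (map_ofNat PowerSeries.C 2).symm, map_sub,
    PowerSeries.coeff_C_mul, PowerSeries.coeff_succ_X_mul, PowerSeries.coeff_mk,
    PowerSeries.coeff_one]
  simp

theorem coeff_sqrtSeries_zero : PowerSeries.coeff 0 sqrtSeries = 1 := by
  simp [sqrtSeries]

theorem absSummable_sqrtSeries : AbsSummable sqrtSeries := by
  unfold AbsSummable
  rw [← summable_nat_add_iff 1]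
  refine summable_catalan_div.congr fun n => ?_
  rw [coeff_sqrtSeries_succ, norm_neg, Complex.norm_real, Real.norm_of_nonneg (by positivity)]

theorem re_psEval_sqrtSeries_nonneg {u : ℂ} (hu : ‖u‖ ≤ 1) : 0 ≤ (psEval sqrtSeries u).re := by
  have hs := absSummable_sqrtSeries.summable_norm hu
  have hs' := (summable_nat_add_iff 1).2 hs
  unfold psEval
  rw [hs.of_norm.tsum_eq_zero_add, coeff_sqrtSeries_zero]
  have hb : ‖∑' n, PowerSeries.coeff (n + 1) sqrtSeries * u ^ (n + 1)‖ ≤ 1 := by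
    refine (norm_tsum_le_tsum_norm hs').trans (le_trans (hs'.tsum_le_tsum (fun n => ?_)
      summable_catalan_div) (summable_catalan_div.tsum_le_of_sum_range_le sum_catalan_div_le))
    rw [norm_mul, norm_pow, coeff_sqrtSeries_succ, norm_neg, Complex.norm_real,
      Real.norm_of_nonneg (by positivity)]
    exact mul_le_of_le_one_right (by positivity) (pow_le_one₀ (norm_nonneg _) hu)
  have := (Complex.abs_re_le_norm _).trans hb
  simp only [pow_zero, mul_one, Complex.add_re, Complex.one_re]
  linarith [neg_abs_le (∑' n, PowerSeries.coeff (n + 1) sqrtSeries * u ^ (n + 1)).re]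

theorem psEval_sqrtSeries_mul_self {u : ℂ} (hu : ‖u‖ ≤ 1) :
    psEval sqrtSeries u * psEval sqrtSeries u = 1 - u := by
  rw [← psEval_mul absSummable_sqrtSeries absSummable_sqrtSeries hu, sqrtSeries_mul_self]
  have := psEval_polynomial (1 - Polynomial.X) u
  simpa using this

/-- A square root with nonnegative real part of a number with nonnegative real part. -/
theorem abs_im_le_re {p q : ℂ} (h : p * p = q) (hp : 0 ≤ p.re) (hq : 0 ≤ q.re) :
    |p.im| ≤ p.re := by
  have := congrArg Complex.re h
  rw [Complex.mul_re] at this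
  exact abs_le_of_sq_le_sq (by nlinarith) hp

/-- Both arguments lie in [-π/4, π/4], so the argument of the product lies in [-π/2, π/2]. -/
theorem re_mul_nonneg {p q : ℂ} (hp : |p.im| ≤ p.re) (hq : |q.im| ≤ q.re) : 0 ≤ (p * q).re := by
  rw [Complex.mul_re, sub_nonneg]
  refine (le_abs_self _).trans ?_
  rw [abs_mul]
  exact mul_le_mul hp hq (abs_nonneg _) ((abs_nonneg _).trans hp)

theorem re_one_sub_nonneg {u : ℂ} (hu : ‖u‖ ≤ 1) : 0 ≤ (1 - u).re := by
  have := (Complex.re_le_norm u).trans hu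
  simp only [Complex.sub_re, Complex.one_re]
  linarith

/-! ### The generating function of the half-line walk -/

/-- The product of the two square roots `√(1 - ν² X²)` and `√(1 - ν̄² X²)`. -/
def discSqrt (c : ℂ) : PowerSeries ℂ :=
  (PowerSeries.rescale c sqrtSeries * PowerSeries.rescale (-c) sqrtSeries) *
    (PowerSeries.rescale (star c) sqrtSeries * PowerSeries.rescale (-star c) sqrtSeries)

theorem rescale_sqrtSeries_mul_self (c : ℂ) :
    PowerSeries.rescale c sqrtSeries * PowerSeries.rescale c sqrtSeries =
      1 - PowerSeries.C c * PowerSeries.X := by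
  rw [← map_mul, sqrtSeries_mul_self, map_sub, map_one, PowerSeries.rescale_X]

theorem discSqrt_mul_self (c : ℂ) : discSqrt c * discSqrt c =
    (1 - (PowerSeries.C c * PowerSeries.X) ^ 2) *
      (1 - (PowerSeries.C (star c) * PowerSeries.X) ^ 2) := by
  have h1 := rescale_sqrtSeries_mul_self c
  have h2 := rescale_sqrtSeries_mul_self (-c)
  have h3 := rescale_sqrtSeries_mul_self (star c)
  have h4 := rescale_sqrtSeries_mul_self (-star c)
  rw [map_neg] at h2 h4
  have h12 : (PowerSeries.rescale c sqrtSeries * PowerSeries.rescale (-c) sqrtSeries) ^ 2 =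
      1 - (PowerSeries.C c * PowerSeries.X) ^ 2 := by
    rw [mul_pow, sq, sq (PowerSeries.rescale (-c) sqrtSeries), h1, h2]
    ring
  have h34 : (PowerSeries.rescale (star c) sqrtSeries *
      PowerSeries.rescale (-star c) sqrtSeries) ^ 2 =
      1 - (PowerSeries.C (star c) * PowerSeries.X) ^ 2 := by
    rw [mul_pow, sq, sq (PowerSeries.rescale (-star c) sqrtSeries), h3, h4]
    ring
  rw [← h12, ← h34, discSqrt]
  ring

theorem constantCoeff_discSqrt (c : ℂ) : PowerSeries.constantCoeff (discSqrt c) = 1 := by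
  have : ∀ d : ℂ, PowerSeries.constantCoeff (PowerSeries.rescale d sqrtSeries) = 1 := by
    intro d
    rw [← PowerSeries.coeff_zero_eq_constantCoeff_apply, PowerSeries.coeff_rescale,
      coeff_sqrtSeries_zero]
    simp
  simp [discSqrt, this]

theorem absSummable_discSqrt {c : ℂ} (hc : ‖c‖ ≤ 1) : AbsSummable (discSqrt c) :=
  ((absSummable_sqrtSeries.rescale hc).mul
    (absSummable_sqrtSeries.rescale (by rwa [norm_neg]))).mul
  ((absSummable_sqrtSeries.rescale (by rwa [norm_star])).mul
    (absSummable_sqrtSeries.rescale (by rwa [norm_neg, norm_star])))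

theorem norm_mul_le_one {c z : ℂ} (hc : ‖c‖ ≤ 1) (hz : ‖z‖ ≤ 1) : ‖c * z‖ ≤ 1 := by
  rw [norm_mul]
  exact mul_le_one₀ hc (norm_nonneg _) hz

/-- Keeps track of the branch: √(1 - u) and √(1 + u) lie in the sector |arg| ≤ π/4, so their product
has nonnegative real part. It squares to 1 - u², which also has nonnegative real part, so the
product is again in the sector. Two such pairs can then be multiplied. -/
theorem abs_im_le_re_sqrtSeries_pair {u : ℂ} (hu : ‖u‖ ≤ 1) :
    |(psEval sqrtSeries u * psEval sqrtSeries (-u)).im| ≤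
      (psEval sqrtSeries u * psEval sqrtSeries (-u)).re := by
  have hu' : ‖-u‖ ≤ 1 := by rwa [norm_neg]
  have hE : ∀ v : ℂ, ‖v‖ ≤ 1 → |(psEval sqrtSeries v).im| ≤ (psEval sqrtSeries v).re :=
    fun v hv => abs_im_le_re (psEval_sqrtSeries_mul_self hv) (re_psEval_sqrtSeries_nonneg hv)
      (re_one_sub_nonneg hv)
  refine abs_im_le_re (q := 1 - u * u) ?_ (re_mul_nonneg (hE u hu) (hE (-u) hu'))
    (re_one_sub_nonneg (norm_mul_le_one hu hu))
  linear_combination (1 + u) * psEval_sqrtSeries_mul_self hu +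
    psEval sqrtSeries u * psEval sqrtSeries u * psEval_sqrtSeries_mul_self hu'

theorem re_psEval_discSqrt_nonneg {c z : ℂ} (hc : ‖c‖ ≤ 1) (hz : ‖z‖ ≤ 1) :
    0 ≤ (psEval (discSqrt c) z).re := by
  have hc1 : ‖-c‖ ≤ 1 := by rwa [norm_neg]
  have hc2 : ‖star c‖ ≤ 1 := by rwa [norm_star]
  have hc3 : ‖-star c‖ ≤ 1 := by rwa [norm_neg]
  have s := fun {d : ℂ} (hd : ‖d‖ ≤ 1) => absSummable_sqrtSeries.rescale hd
  rw [discSqrt, psEval_mul ((s hc).mul (s hc1)) ((s hc2).mul (s hc3)) hz,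
    psEval_mul (s hc) (s hc1) hz, psEval_mul (s hc2) (s hc3) hz]
  simp only [psEval_rescale, neg_mul]
  exact re_mul_nonneg (abs_im_le_re_sqrtSeries_pair (norm_mul_le_one hc hz))
    (abs_im_le_re_sqrtSeries_pair (norm_mul_le_one hc2 hz))

/-- For a number `a ∈ [0, 1]` there is a power series `R` with absolutely summable coefficients,
`R(0) = 1`, `R² = (1 + X²)² - 4 a² X²`, and nonnegative real part on the closed unit disc. -/
theorem exists_discSqrt {t : ℝ} (h0 : 0 ≤ t) (h1 : t ≤ 1) : ∃ R : PowerSeries ℂ,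
    AbsSummable R ∧ PowerSeries.constantCoeff R = 1 ∧
    R * R = (1 + PowerSeries.X ^ 2) ^ 2 - 4 * PowerSeries.C (t : ℂ) * PowerSeries.X ^ 2 ∧
    ∀ z : ℂ, ‖z‖ ≤ 1 → 0 ≤ (psEval R z).re := by
  -- Chosen so that |c| = 1 and c² + conj c² = 4t - 2, which gives (1 - c²X²)(1 - conj c² X²) = (1 +
  -- X²)² - 4tX². The branch points thus lie on the unit circle.
  set c : ℂ := ⟨√t, √(1 - t)⟩ with hcdef
  have e1 : √t * √t = t := Real.mul_self_sqrt h0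
  have e2 : √(1 - t) * √(1 - t) = 1 - t := Real.mul_self_sqrt (by linarith)
  have hmul : c * star c = 1 := by
    rw [Complex.star_def, Complex.mul_conj, Complex.normSq_apply, hcdef]
    simp [e1, e2]
  have hadd : c ^ 2 + star c ^ 2 = 4 * t - 2 := by
    apply Complex.ext
    · simp [hcdef, sq, e1, e2]
      ring
    · simp [hcdef, sq]
      ring
  have hnorm : ‖c‖ = 1 := by
    have : ‖c‖ ^ 2 = 1 := by
      rw [← Complex.normSq_eq_norm_sq, Complex.normSq_apply, hcdef]
      simp [e1, e2]
    nlinarith [norm_nonneg c]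
  refine ⟨discSqrt c, absSummable_discSqrt hnorm.le, constantCoeff_discSqrt c, ?_,
    fun z hz => re_psEval_discSqrt_nonneg hnorm.le hz⟩
  have k1 : PowerSeries.C c * PowerSeries.C (star c) = (1 : PowerSeries ℂ) := by
    rw [← map_mul, hmul, map_one]
  have k2 : PowerSeries.C c ^ 2 + PowerSeries.C (star c) ^ 2 =
      4 * PowerSeries.C (t : ℂ) - (2 : PowerSeries ℂ) := by
    rw [← map_pow, ← map_pow, ← map_add, hadd, map_sub, map_mul, map_ofNat, map_ofNat]
  rw [discSqrt_mul_self]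
  linear_combination (-PowerSeries.X ^ 2) * k2 + PowerSeries.X ^ 4 *
    (PowerSeries.C c * PowerSeries.C (star c) + 1) * k1

/-- The generating functions of the half-line walk. -/
theorem halfLineWalk_eq_coeff {A B : ℂ} {x D : PowerSeries ℂ}
    (hAB : A * star A + B * star B = 1)
    (hx : PowerSeries.C A * PowerSeries.X * x ^ 2 - (1 + PowerSeries.X ^ 2) * x +
      PowerSeries.X * PowerSeries.C (star A) = 0)
    (hD : (1 - PowerSeries.C A * PowerSeries.X * x - PowerSeries.C B * PowerSeries.X) * D = 1)
    (n j : ℕ) :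
    (halfLineWalk A B n j).1 = PowerSeries.coeff n
      (x ^ (j + 1) * PowerSeries.X * PowerSeries.C B * D) ∧
    (halfLineWalk A B n j).2 = PowerSeries.coeff n
      (x ^ j * (1 - PowerSeries.C A * PowerSeries.X * x) * D) := by
  have hAB' : PowerSeries.C A * PowerSeries.C (star A) +
      PowerSeries.C B * PowerSeries.C (star B) = (1 : PowerSeries ℂ) := by
    rw [← map_mul, ← map_mul, ← map_add, hAB, map_one]
  have hx0 : PowerSeries.constantCoeff x = 0 := by
    have := congrArg PowerSeries.constantCoeff hx
    simpa using this
  have hD0 : PowerSeries.constantCoeff D = 1 := by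
    have := congrArg PowerSeries.constantCoeff hD
    simpa [hx0] using this
  set G0 : ℕ → PowerSeries ℂ := fun j => x ^ (j + 1) * PowerSeries.X * PowerSeries.C B * D with hG0
  set G1 : ℕ → PowerSeries ℂ := fun j => x ^ j * (1 - PowerSeries.C A * PowerSeries.X * x) * D
    with hG1
  -- The candidates are geometric in j with ratio x. Of the three recursions, `r0` is an identity,
  -- `r1` is the quadratic `hx` together with unitarity, and `r2` is the boundary equation that
  -- fixes the normalisation D.
  have r0 : ∀ j, G0 j = PowerSeries.X *
      (PowerSeries.C A * G0 (j + 1) + PowerSeries.C B * G1 (j + 1)) := by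
    intro j
    simp only [hG0, hG1]
    ring
  have r1 : ∀ j, G1 (j + 1) = PowerSeries.X *
      (PowerSeries.C (-star B) * G0 j + PowerSeries.C (star A) * G1 j) := by
    intro j
    simp only [hG0, hG1, map_neg]
    linear_combination (-x ^ j * D) * hx + x ^ (j + 1) * PowerSeries.X ^ 2 * D * hAB'
  have r2 : G1 0 = 1 + PowerSeries.X * (PowerSeries.C A * G0 0 + PowerSeries.C B * G1 0) := by
    simp only [hG0, hG1]
    linear_combination hD
  change (halfLineWalk A B n j).1 = PowerSeries.coeff n (G0 j) ∧
    (halfLineWalk A B n j).2 = PowerSeries.coeff n (G1 j)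
  induction n generalizing j with
  | zero =>
    cases j with
    | zero => simp [halfLineWalk, hG0, hG1, hD0]
    | succ j => simp [halfLineWalk, hG0, hG1, hx0]
  | succ n ih =>
    refine ⟨?_, ?_⟩
    · rw [r0, PowerSeries.coeff_succ_X_mul, map_add, PowerSeries.coeff_C_mul,
        PowerSeries.coeff_C_mul, halfLineWalk_succ_fst, (ih _).1, (ih _).2]
    · cases j with
      | zero =>
        rw [r2, map_add, PowerSeries.coeff_succ_X_mul, map_add, PowerSeries.coeff_C_mul,
          PowerSeries.coeff_C_mul, halfLineWalk_succ_snd_zero, (ih _).1, (ih _).2,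
          PowerSeries.coeff_one, if_neg n.succ_ne_zero, zero_add]
      | succ j =>
        rw [r1, PowerSeries.coeff_succ_X_mul, map_add, PowerSeries.coeff_C_mul,
          PowerSeries.coeff_C_mul, halfLineWalk_succ_snd_succ, (ih _).1, (ih _).2]

theorem one_sub_mul_geom (l : ℂ) :
    (1 - PowerSeries.C l * PowerSeries.X) * PowerSeries.mk (fun n => l ^ n) = 1 := by
  ext n
  rw [sub_mul, one_mul, mul_assoc, map_sub, PowerSeries.coeff_C_mul]
  cases n with
  | zero => simp
  | succ n =>
    rw [PowerSeries.coeff_succ_X_mul, PowerSeries.coeff_one, if_neg n.succ_ne_zero]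
    simp [pow_succ']

/-- The boundary amplitude as a combination of two geometric convolutions. -/
theorem exists_boundary_series {A B : ℂ} (hA : A ≠ 0)
    (hAB : Complex.normSq A + Complex.normSq B = 1) :
    ∃ R : PowerSeries ℂ, AbsSummable R ∧
      R * R = (1 + PowerSeries.X ^ 2) ^ 2
        - 4 * PowerSeries.C (Complex.normSq A : ℂ) * PowerSeries.X ^ 2 ∧
      (∀ z : ℂ, ‖z‖ ≤ 1 → 0 ≤ (psEval R z).re) ∧
      ∃ W : PowerSeries ℂ, (∀ n, (halfLineWalk A B n 0).2 = PowerSeries.coeff n W) ∧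
        W * (1 + PowerSeries.C (star B - B) * PowerSeries.X - PowerSeries.X ^ 2) =
          PowerSeries.C (1 / 2 : ℂ) * (R + (1 + 2 * PowerSeries.C (star B) * PowerSeries.X
            - PowerSeries.X ^ 2)) := by
  have hA1 : Complex.normSq A ≤ 1 := by linarith [Complex.normSq_nonneg B]
  obtain ⟨R, hR, hR0, hRR, hRe⟩ := exists_discSqrt (Complex.normSq_nonneg A) hA1
  refine ⟨R, hR, hRR, hRe, ?_⟩
  have hAs : A * star A = (Complex.normSq A : ℂ) := Complex.mul_conj A
  have hBs : B * star B = (Complex.normSq B : ℂ) := Complex.mul_conj B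
  have hABc : A * star A + B * star B = 1 := by
    rw [hAs, hBs]
    exact_mod_cast hAB
  -- Here y stands for A X x, a root of y² - (1 + X²) y + |A|² X² = 0. The normalisation R(0) = 1
  -- selects the root with y(0) = 0, so y is divisible by X and x is a power series.
  set y : PowerSeries ℂ := PowerSeries.C (1 / 2 : ℂ) * (1 + PowerSeries.X ^ 2 - R) with hy
  have h2 : 2 * PowerSeries.C (1 / 2 : ℂ) = (1 : PowerSeries ℂ) := by
    rw [← map_ofNat (PowerSeries.C (R := ℂ)) 2, ← map_mul]
    norm_num
  have hyR : R = 1 + PowerSeries.X ^ 2 - 2 * y := by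
    rw [hy]
    linear_combination (1 + PowerSeries.X ^ 2 - R) * h2
  have hCA : PowerSeries.C (Complex.normSq A : ℂ) =
      PowerSeries.C A * PowerSeries.C (star A) := by
    rw [← map_mul, hAs]
  have hyy : y ^ 2 = (1 + PowerSeries.X ^ 2) * y
      - PowerSeries.C A * PowerSeries.C (star A) * PowerSeries.X ^ 2 := by
    rw [hyR, hCA] at hRR
    have h4 : PowerSeries.C (1 / 2 : ℂ) ^ 2 * 4 = (1 : PowerSeries ℂ) := by
      linear_combination (2 * PowerSeries.C (1 / 2 : ℂ) + 1) * h2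
    linear_combination PowerSeries.C (1 / 2 : ℂ) ^ 2 * hRR - (y ^ 2 - ((1 + PowerSeries.X ^ 2) * y
      - PowerSeries.C A * PowerSeries.C (star A) * PowerSeries.X ^ 2)) * h4
  obtain ⟨w, hw⟩ : PowerSeries.X ∣ y := by
    rw [PowerSeries.X_dvd_iff, hy]
    simp [hR0]
  set x : PowerSeries ℂ := PowerSeries.C A⁻¹ * w with hxdef
  have hAi : PowerSeries.C A * PowerSeries.C A⁻¹ = (1 : PowerSeries ℂ) := by
    rw [← map_mul, mul_inv_cancel₀ hA, map_one]
  have hyx : y = PowerSeries.C A * PowerSeries.X * x := by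
    rw [hw, hxdef]
    linear_combination (-PowerSeries.X * w) * hAi
  have hx : PowerSeries.C A * PowerSeries.X * x ^ 2 - (1 + PowerSeries.X ^ 2) * x +
      PowerSeries.X * PowerSeries.C (star A) = 0 := by
    have hne : PowerSeries.C A * PowerSeries.X ≠ (0 : PowerSeries ℂ) := by
      refine mul_ne_zero (fun h => hA ?_) PowerSeries.X_ne_zero
      simpa using congrArg PowerSeries.constantCoeff h
    apply mul_left_cancel₀ hne
    rw [hyx] at hyy
    linear_combination hyy
  set D := (1 - PowerSeries.C A * PowerSeries.X * x - PowerSeries.C B * PowerSeries.X)⁻¹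
  have hD : (1 - PowerSeries.C A * PowerSeries.X * x - PowerSeries.C B * PowerSeries.X) * D = 1 :=
    PowerSeries.mul_inv_cancel _ (by simp)
  refine ⟨(1 - y) * D, fun n => ?_, ?_⟩
  · rw [(halfLineWalk_eq_coeff hABc hx hD n 0).2, pow_zero, one_mul, hyx]
  · rw [← hyx] at hD
    have hB1 : PowerSeries.C A * PowerSeries.C (star A) +
        PowerSeries.C B * PowerSeries.C (star B) = (1 : PowerSeries ℂ) := by
      rw [← map_mul, ← map_mul, ← map_add, hABc, map_one]
    have hN : PowerSeries.C (1 / 2 : ℂ) * (R + (1 + 2 * PowerSeries.C (star B) * PowerSeries.X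
        - PowerSeries.X ^ 2)) = 1 + PowerSeries.C (star B) * PowerSeries.X - y := by
      rw [hyR]
      linear_combination (1 + PowerSeries.C (star B) * PowerSeries.X - y) * h2
    rw [hN, map_sub]
    -- Rationalises the denominator: by the quadratic for y and unitarity, (1 + star B X - y)(1 - y
    -- - B X) = (1 - y)(1 + (star B - B) X - X²).
    linear_combination (1 + PowerSeries.C (star B) * PowerSeries.X - y) * hD +
      D * (-hyy + PowerSeries.X ^ 2 * hB1)

/-! ### Edge state and long-time limit of the half-line walk -/

/-- The eigenvalue of the edge state. -/
def edgePhase (B : ℂ) : ℂ := ((SignType.sign B.re : ℝ) * √(1 - B.im ^ 2) : ℝ) + B.im * Complex.I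

/-- The weight of the edge state in the initial state. -/
def edgeWeight (B : ℂ) : ℝ := |B.re| / √(1 - B.im ^ 2)

/-- The value at a boundary pole of the square root in the generating function. -/
theorem pole_mul_psEval_discSqrt {R : PowerSeries ℂ} {t u b S e : ℝ} {l : ℂ} (hR : AbsSummable R)
    (hRR : R * R = (1 + PowerSeries.X ^ 2) ^ 2
        - 4 * PowerSeries.C (t : ℂ) * PowerSeries.X ^ 2)
    (hRe : ∀ z : ℂ, ‖z‖ ≤ 1 → 0 ≤ (psEval R z).re) (hS0 : 0 < S) (hSt : S ^ 2 - t = u ^ 2)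
    (he : e ^ 2 = 1) (hl : l = ((e * S : ℝ) : ℂ) + b * Complex.I) (hn : ‖l‖ = 1) :
    l * psEval R (star l) = 2 * (e * |u| : ℝ) := by
  have hz : ‖star l‖ ≤ 1 := by rw [norm_star, hn]
  have hll : l * star l = 1 := by
    rw [Complex.star_def, Complex.mul_conj, Complex.normSq_eq_norm_sq, hn]
    simp
  have hsum : l + star l = 2 * (e * S : ℝ) := by
    rw [hl]
    apply Complex.ext <;> simp
    ring
  have hRR' : psEval R (star l) * psEval R (star l) = (1 + star l ^ 2) ^ 2
      - 4 * (t : ℂ) * star l ^ 2 := by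
    have hpoly : (1 + PowerSeries.X ^ 2) ^ 2 - 4 * PowerSeries.C (t : ℂ) * PowerSeries.X ^ 2 =
        (((1 + Polynomial.X ^ 2) ^ 2 - Polynomial.C (4 * (t : ℂ)) * Polynomial.X ^ 2 :
          Polynomial ℂ) : PowerSeries ℂ) := by
      simp only [Polynomial.coe_sub, Polynomial.coe_mul, Polynomial.coe_add, Polynomial.coe_pow,
        Polynomial.coe_one, Polynomial.coe_X, Polynomial.coe_C]
      simp only [map_mul, map_ofNat]
    rw [← psEval_mul hR hR hz, hRR, hpoly, psEval_polynomial]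
    simp only [Polynomial.eval_sub, Polynomial.eval_add, Polynomial.eval_one, Polynomial.eval_mul,
      Polynomial.eval_C, Polynomial.eval_X, Polynomial.eval_pow]
  have hre := hRe _ hz
  have hlre : (star l).re = e * S := by simp [hl]
  clear hl hR hRR hRe
  generalize psEval R (star l) = p at *
  generalize hm : star l = m at *
  -- Multiplying by l makes the value real: l (1 + (star l)²) = l + star l = 2 e S, so (l p)² = 4 S²
  -- - 4 t = 4 u² and ρ = ±u.
  obtain ⟨ρ, hρ⟩ : ∃ ρ, ρ = l * p / 2 := ⟨_, rfl⟩
  have hρR : p = m * ((2 : ℝ) * ρ) := by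
    rw [hρ]
    push_cast
    linear_combination (-p) * hll
  have hρ2 : ρ * ρ = (u : ℂ) * u := by
    have e2 : l * (1 + m ^ 2) = 2 * (e * S : ℝ) := by
      rw [← hsum]
      linear_combination m * hll
    have e3 : ρ * ρ = ((l * (1 + m ^ 2)) ^ 2 - 4 * (t : ℂ) * (l * m) ^ 2) / 4 := by
      rw [hρ]
      linear_combination l ^ 2 / 4 * hRR'
    rw [e3, e2, hll]
    have : (2 * (e * S)) ^ 2 - 4 * t = 4 * (u * u) := by
      linear_combination 4 * hSt + 4 * S ^ 2 * he
    have := congrArg (fun r : ℝ => (r : ℂ)) this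
    push_cast at this ⊢
    linear_combination this / 4
  -- The sign is decided by Re p ≥ 0: as p = 2 ρ star l and Re (star l) = e S with S > 0, it follows
  -- that e ρ ≥ 0.
  have hcase : ∀ w : ℝ, |w| = |u| → ρ = w → l * p = 2 * (e * |u| : ℝ) := by
    intro w hw h
    rw [hρR, h, ← Complex.ofReal_mul, Complex.re_mul_ofReal, hlre] at hre
    have hew : 0 ≤ e * w := by
      have : 0 ≤ S * (e * w) := by linarith
      exact nonneg_of_mul_nonneg_right this hS0
    have : e * |u| = w := by
      rw [← hw]
      rcases (sq_eq_sq_iff_eq_or_eq_neg.1 (he.trans (one_pow 2).symm)) with rfl | rfl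
      · rw [abs_of_nonneg (by linarith)]; ring
      · rw [abs_of_nonpos (by linarith)]; ring
    rw [this, ← h, hρ]
    ring
  rcases mul_self_eq_mul_self_iff.1 hρ2 with h | h
  · exact hcase u rfl h
  · exact hcase (-u) (abs_neg u) (by rw [h, Complex.ofReal_neg])

/-- The denominator is (1 - l₊X)(1 - l₋X) with l_± = ±S + i Im B of modulus one. The numerator N
satisfies l_e N(star l_e) = 2 (Re B + e |Re B|), so only the pole with e = sign (Re B) contributes.
-/
theorem tendsto_boundary {A B : ℂ} (hA : A ≠ 0)
    (hAB : Complex.normSq A + Complex.normSq B = 1) (hB : B.re ≠ 0) :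
    Tendsto (fun n => (halfLineWalk A B n 0).2 - edgeWeight B * edgePhase B ^ n)
      atTop (𝓝 0) := by
  obtain ⟨R, hR, hRR, hRe, W, hW, hWq⟩ := exists_boundary_series hA hAB
  set b := B.im with hb
  set S := √(1 - b ^ 2) with hS
  have hApos : 0 < Complex.normSq A := Complex.normSq_pos.2 hA
  have hBsq : Complex.normSq B = B.re ^ 2 + b ^ 2 := by
    rw [Complex.normSq_apply]
    ring
  have hS2 : S ^ 2 = 1 - b ^ 2 := Real.sq_sqrt (by nlinarith [sq_nonneg B.re])
  have hS0 : 0 < S := Real.sqrt_pos.2 (by nlinarith [sq_nonneg B.re])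
  set l : ℝ → ℂ := fun e => ((e * S : ℝ) : ℂ) + b * Complex.I with hl
  set N : PowerSeries ℂ := R + ((1 + Polynomial.C (2 * star B) * Polynomial.X
    - Polynomial.X ^ 2 : Polynomial ℂ) : PowerSeries ℂ) with hN
  have hNs : AbsSummable N := hR.add (AbsSummable.polynomial _)
  -- values at the two poles
  have hval : ∀ e : ℝ, e ^ 2 = 1 → ‖l e‖ = 1 ∧
      l e * psEval N (star (l e)) = 2 * (B.re + e * |B.re| : ℝ) := by
    intro e he
    have hn2 : Complex.normSq (l e) = 1 := by
      simp only [hl, Complex.normSq_add_mul_I]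
      rw [mul_pow, he, hS2]
      ring
    have hn : ‖l e‖ = 1 := by
      rw [Complex.normSq_eq_norm_sq] at hn2
      nlinarith [norm_nonneg (l e)]
    refine ⟨hn, ?_⟩
    have hz : ‖star (l e)‖ ≤ 1 := by rw [norm_star, hn]
    have hll : l e * star (l e) = 1 := by
      rw [Complex.star_def, Complex.mul_conj, hn2, Complex.ofReal_one]
    have hp : l e * psEval R (star (l e)) = 2 * (e * |B.re| : ℝ) := pole_mul_psEval_discSqrt (u := B.re) hR hRR hRe hS0
      (by rw [hS2]; linarith) he rfl hn
    rw [hN, psEval_add hR (AbsSummable.polynomial _) hz, psEval_polynomial]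
    simp only [Polynomial.eval_sub, Polynomial.eval_add, Polynomial.eval_one, Polynomial.eval_mul,
      Polynomial.eval_C, Polynomial.eval_X, Polynomial.eval_pow]
    have hBl : (l e - star (l e)) / 2 + star B = B.re := by
      apply Complex.ext <;> simp [hl, ← hb]
    push_cast at hp ⊢
    linear_combination hp + (2 * star B - star (l e)) * hll + 2 * hBl
  obtain ⟨hl1, hv1⟩ := hval 1 (by norm_num)
  obtain ⟨hl2, hv2⟩ := hval (-1) (by norm_num)
  -- Partial fractions; the constant 1/(4S) combines the prefactor 1/2 of W with l₊ - l₋ = 2S.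
  have hWn : ∀ n, PowerSeries.coeff n W = (1 / (4 * S : ℂ)) *
      (l 1 * PowerSeries.coeff n (PowerSeries.mk (fun n => l 1 ^ n) * N)
        - l (-1) * PowerSeries.coeff n (PowerSeries.mk (fun n => l (-1) ^ n) * N)) := by
    have hSc : (S : ℂ) ≠ 0 := by exact_mod_cast hS0.ne'
    have hq : 1 + PowerSeries.C (star B - B) * PowerSeries.X - PowerSeries.X ^ 2 =
        (1 - PowerSeries.C (l 1) * PowerSeries.X) * (1 - PowerSeries.C (l (-1)) * PowerSeries.X) := by
      have s1 : star B - B = -(l 1 + l (-1)) := by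
        apply Complex.ext <;> simp [hl, ← hb]
        ring
      have s2 : l 1 * l (-1) = -1 := by
        have : ((S ^ 2 : ℝ) : ℂ) = ((1 - b ^ 2 : ℝ) : ℂ) := by rw [hS2]
        push_cast at this
        simp only [hl]
        push_cast
        linear_combination (b : ℂ) ^ 2 * Complex.I_sq - this
      have s2' : PowerSeries.C (l 1) * PowerSeries.C (l (-1)) = (-1 : PowerSeries ℂ) := by
        rw [← map_mul, s2, map_neg, map_one]
      rw [s1, map_neg, map_add]
      linear_combination (-PowerSeries.X ^ 2) * s2'
    have g1 := one_sub_mul_geom (l 1)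
    have g2 := one_sub_mul_geom (l (-1))
    set k1 := PowerSeries.mk (fun n => l 1 ^ n)
    set k2 := PowerSeries.mk (fun n => l (-1) ^ n)
    have hdiff : l 1 - l (-1) = 2 * S := by
      simp only [hl]
      push_cast
      ring
    have hdiffC : PowerSeries.C (1 / (4 * S : ℂ)) * (PowerSeries.C (l 1) - PowerSeries.C (l (-1))) =
        (PowerSeries.C (1 / 2 : ℂ)) := by
      rw [← map_sub, ← map_mul, hdiff]
      congr 1
      field_simp
      norm_num
    have hNpol : N = R + (1 + 2 * PowerSeries.C (star B) * PowerSeries.X - PowerSeries.X ^ 2) := by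
      rw [hN]
      simp only [Polynomial.coe_sub, Polynomial.coe_mul, Polynomial.coe_add, Polynomial.coe_pow,
        Polynomial.coe_one, Polynomial.coe_X, Polynomial.coe_C]
      simp only [map_mul, map_ofNat]
    have hWk : W = PowerSeries.C (1 / (4 * S : ℂ)) *
        (PowerSeries.C (l 1) * (k1 * N) - PowerSeries.C (l (-1)) * (k2 * N)) := by
      rw [hq, ← hNpol] at hWq
      have w1 : W = PowerSeries.C (1 / 2 : ℂ) * (N * (k1 * k2)) := by
        linear_combination k1 * k2 * hWq
          - W * (1 - PowerSeries.C (l (-1)) * PowerSeries.X) * k2 * g1 - W * g2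
      have w2 : PowerSeries.C (l 1) * k1 - PowerSeries.C (l (-1)) * k2 =
          (PowerSeries.C (l 1) - PowerSeries.C (l (-1))) * (k1 * k2) := by
        linear_combination PowerSeries.C (l (-1)) * k2 * g1 - PowerSeries.C (l 1) * k1 * g2
      rw [w1, ← hdiffC]
      linear_combination (-PowerSeries.C (1 / (4 * S : ℂ)) * N) * w2
    intro n
    rw [hWk, PowerSeries.coeff_C_mul, map_sub, PowerSeries.coeff_C_mul, PowerSeries.coeff_C_mul]
  have hlim := ((((tendsto_coeff_mul_geom hNs hl1).const_mul (l 1)).sub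
    ((tendsto_coeff_mul_geom hNs hl2).const_mul (l (-1)))).const_mul (1 / (4 * S : ℂ)))
  simp only [mul_zero, sub_zero] at hlim
  refine hlim.congr fun n => ?_
  rw [hW, hWn]
  have hSc : (S : ℂ) ≠ 0 := by exact_mod_cast hS0.ne'
  have hfin : (edgeWeight B : ℂ) * edgePhase B ^ n = (1 / (4 * S : ℂ)) *
      (2 * (B.re + 1 * |B.re| : ℝ) * l 1 ^ n - 2 * (B.re + -1 * |B.re| : ℝ) * l (-1) ^ n) := by
    rcases hB.lt_or_gt with h | h
    · have : edgePhase B = l (-1) := by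
        simp [edgePhase, hl, sign_neg h, hS, hb]
      rw [this, edgeWeight, abs_of_neg h, ← hb, ← hS]
      push_cast
      field_simp
      ring
    · have : edgePhase B = l 1 := by
        simp [edgePhase, hl, sign_pos h, hS, hb]
      rw [this, edgeWeight, abs_of_pos h, ← hb, ← hS]
      push_cast
      field_simp
      ring
  rw [hfin, ← hv1, ← hv2]
  ring

/-- The spatial decay rate of the edge state. -/
def edgeDecay (A B : ℂ) : ℂ := (edgePhase B - B) / A

/-- The characteristic equation λ² - (B - star B) λ - 1 = 0, obtained by eliminating the ratio x
from λ = A x + B and λ x = -star B x + star A. -/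
theorem edgePhase_mul_self {A B : ℂ} (hAB : Complex.normSq A + Complex.normSq B = 1)
    (hB : B.re ≠ 0) : edgePhase B ^ 2 = 1 + 2 * B.im * Complex.I * edgePhase B := by
  have hS2 : √(1 - B.im ^ 2) ^ 2 = 1 - B.im ^ 2 := by
    refine Real.sq_sqrt ?_
    have := Complex.normSq_nonneg A
    rw [Complex.normSq_apply B] at hAB
    nlinarith [sq_nonneg B.re]
  have hσ : ((SignType.sign B.re : SignType) : ℝ) ^ 2 = 1 := by
    rcases hB.lt_or_gt with h | h
    · simp [sign_neg h]
    · simp [sign_pos h]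
  have h : (((SignType.sign B.re : ℝ) * √(1 - B.im ^ 2)) ^ 2 : ℝ) = 1 - B.im ^ 2 := by
    rw [mul_pow, hσ, hS2, one_mul]
  have h' := congrArg (fun r : ℝ => (r : ℂ)) h
  rw [edgePhase]
  generalize (SignType.sign B.re : ℝ) * √(1 - B.im ^ 2) = q at h'
  push_cast at h' ⊢
  linear_combination h' - (B.im : ℂ) ^ 2 * Complex.I_sq

/-- The boundary limit determines all the others. The recursion expresses A u_i + B w_i at time n as
an amplitude at time n + 1 whose limit is already known; as A ≠ 0, this gives the left-moving u_i
from the right-moving w_i, and then w_{i+1} follows. The profile w_j = x^j, u_j = x^(j+1) is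
consistent because it is an eigenvector for λ. -/
theorem tendsto_halfLineWalk {A B : ℂ} (hA : A ≠ 0)
    (hAB : Complex.normSq A + Complex.normSq B = 1) (hB : B.re ≠ 0) (j : ℕ) :
    Tendsto (fun n => (halfLineWalk A B n j).2
      - edgeWeight B * edgePhase B ^ n * edgeDecay A B ^ j) atTop (𝓝 0) ∧
    Tendsto (fun n => (halfLineWalk A B n j).1
      - edgeWeight B * edgePhase B ^ n * edgeDecay A B ^ (j + 1)) atTop (𝓝 0) := by
  set l := edgePhase B with hl
  set x := edgeDecay A B with hx
  have hxA : A * x = l - B := by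
    rw [hx, edgeDecay, mul_div_cancel₀ _ hA]
  have hAs : A * star A + B * star B = 1 := by
    rw [Complex.star_def, Complex.mul_conj, Complex.mul_conj]
    exact_mod_cast hAB
  have hlx : l * x = -star B * x + star A := by
    apply mul_left_cancel₀ hA
    have hBB : B - star B = 2 * B.im * Complex.I := by
      apply Complex.ext <;> simp
      ring
    linear_combination (l + star B) * hxA + edgePhase_mul_self hAB hB - hAs - l * hBB
  -- the left-moving amplitude follows from the right-moving ones
  have left : ∀ i, Tendsto (fun n => (A * (halfLineWalk A B n i).1 + B * (halfLineWalk A B n i).2)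
        - edgeWeight B * l ^ (n + 1) * x ^ i) atTop (𝓝 0) →
      Tendsto (fun n => (halfLineWalk A B n i).2 - edgeWeight B * l ^ n * x ^ i) atTop (𝓝 0) →
      Tendsto (fun n => (halfLineWalk A B n i).1 - edgeWeight B * l ^ n * x ^ (i + 1))
        atTop (𝓝 0) := by
    intro i h1 h2
    have := (h1.sub (h2.const_mul B)).const_mul A⁻¹
    simp only [mul_zero, sub_zero] at this
    refine this.congr fun n => ?_
    apply mul_left_cancel₀ hA
    rw [mul_inv_cancel_left₀ hA]
    linear_combination (edgeWeight B * l ^ n * x ^ i : ℂ) * hxA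
  induction j with
  | zero =>
    have h0 : Tendsto (fun n => (halfLineWalk A B n 0).2 - edgeWeight B * l ^ n * x ^ 0)
        atTop (𝓝 0) := by simpa using tendsto_boundary hA hAB hB
    refine ⟨h0, left 0 ?_ h0⟩
    refine ((tendsto_add_atTop_iff_nat 1).2 h0).congr fun n => ?_
    rw [halfLineWalk_succ_snd_zero]
  | succ j ih =>
    obtain ⟨h2, h1⟩ := ih
    have h2' : Tendsto (fun n => (halfLineWalk A B n (j + 1)).2
        - edgeWeight B * l ^ n * x ^ (j + 1)) atTop (𝓝 0) := by
      rw [← tendsto_add_atTop_iff_nat 1]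
      have := (h1.const_mul (-star B)).add (h2.const_mul (star A))
      simp only [mul_zero, add_zero] at this
      refine this.congr fun n => ?_
      rw [halfLineWalk_succ_snd_succ]
      linear_combination (edgeWeight B * l ^ n * x ^ j : ℂ) * hlx
    refine ⟨h2', left (j + 1) ?_ h2'⟩
    refine ((tendsto_add_atTop_iff_nat 1).2 h1).congr fun n => ?_
    rw [halfLineWalk_succ_fst]

/-! ### The limit density in terms of the momentum -/

/-- The modulus of the real part of the eigenvalue of the edge state at momentum `k`. -/
def edgeCos (r k : ℝ) : ℝ := √(1 - r ^ 2 * Real.sin k ^ 2)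

/-- The group velocity of the edge state at momentum `k`. -/
def edgeVel (r s k : ℝ) : ℝ :=
  (SignType.sign (s * r) : ℝ) * (|r| * |Real.cos k| / edgeCos r k)

/-- The overlap of the edge state at momentum `k` with the initial state. -/
def edgeOverlap (r s k : ℝ) : ℝ := |s| * |Real.cos k| / edgeCos r k

/-- The asymptotic probability of the `j`-th horizontal arc at momentum `k`. -/
def edgeProb (r s : ℝ) (j : ℕ) (k : ℝ) : ℝ :=
  edgeOverlap r s k ^ 2 *
    ((1 - edgeOverlap r s k) / (1 + edgeOverlap r s k)) ^ ⌈(j : ℝ) / 2⌉₊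

section

variable {r s : ℝ}

theorem sq_lt_one_of_abs (hr1 : |r| < 1) : r ^ 2 < 1 := by
  rw [← sq_abs]
  nlinarith [abs_nonneg r]

theorem one_sub_sq_mul_pos (hr1 : |r| < 1) (k : ℝ) : 0 < 1 - r ^ 2 * Real.sin k ^ 2 := by
  have h := sq_lt_one_of_abs hr1
  nlinarith [sq_nonneg (Real.sin k), Real.sin_sq_le_one k, sq_nonneg r]

theorem edgeCos_pos (hr1 : |r| < 1) (k : ℝ) : 0 < edgeCos r k :=
  Real.sqrt_pos.2 (one_sub_sq_mul_pos hr1 k)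

theorem edgeCos_sq (hr1 : |r| < 1) (k : ℝ) : edgeCos r k ^ 2 = 1 - r ^ 2 * Real.sin k ^ 2 :=
  Real.sq_sqrt (one_sub_sq_mul_pos hr1 k).le

theorem continuous_edgeCos (r : ℝ) : Continuous (edgeCos r) := by
  unfold edgeCos
  fun_prop

theorem continuous_edgeVel (hr1 : |r| < 1) (s : ℝ) : Continuous (edgeVel r s) :=
  continuous_const.mul (Continuous.div (by fun_prop) (continuous_edgeCos r)
    fun k => (edgeCos_pos hr1 k).ne')

theorem continuous_edgeOverlap (hr1 : |r| < 1) (s : ℝ) : Continuous (edgeOverlap r s) :=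
  Continuous.div (by fun_prop) (continuous_edgeCos r) fun k => (edgeCos_pos hr1 k).ne'

theorem edgeOverlap_nonneg (r s k : ℝ) : 0 ≤ edgeOverlap r s k := by
  unfold edgeOverlap edgeCos
  positivity

theorem edgeOverlap_le_one (hr1 : |r| < 1) (hs1 : |s| ≤ 1) (k : ℝ) : edgeOverlap r s k ≤ 1 := by
  rw [edgeOverlap, div_le_one (edgeCos_pos hr1 k)]
  refine abs_le_of_sq_le_sq' ?_ (edgeCos_pos hr1 k).le |>.2
  rw [edgeCos_sq hr1, mul_pow, sq_abs, sq_abs]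
  have h1 := sq_lt_one_of_abs hr1
  have h2 : s ^ 2 ≤ 1 := (sq_le_one_iff_abs_le_one s).2 hs1
  nlinarith [sq_nonneg (Real.sin k), sq_nonneg (Real.cos k), Real.sin_sq_add_cos_sq k]

theorem continuous_edgeProb (hr1 : |r| < 1) (s : ℝ) (j : ℕ) : Continuous (edgeProb r s j) := by
  have h := continuous_edgeOverlap hr1 s
  exact (h.pow 2).mul (((continuous_const.sub h).div (continuous_const.add h)
    fun k => (by linarith [edgeOverlap_nonneg r s k] : (0 : ℝ) < 1 + edgeOverlap r s k).ne').pow _)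

theorem edgeProb_nonneg (hr1 : |r| < 1) (hs1 : |s| ≤ 1) (j : ℕ) (k : ℝ) :
    0 ≤ edgeProb r s j k := by
  have h1 := edgeOverlap_nonneg r s k
  have h2 := edgeOverlap_le_one hr1 hs1 k
  exact mul_nonneg (sq_nonneg _) (pow_nonneg (div_nonneg (by linarith) (by linarith)) _)

theorem natCeil_half_even (n : ℕ) : ⌈((2 * n : ℕ) : ℝ) / 2⌉₊ = n := by
  rw [show ((2 * n : ℕ) : ℝ) / 2 = n by push_cast; ring, Nat.ceil_natCast]

theorem natCeil_half_odd (n : ℕ) : ⌈((2 * n + 1 : ℕ) : ℝ) / 2⌉₊ = n + 1 := by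
  rw [Nat.ceil_eq_iff (by omega)]
  constructor <;> push_cast <;> linarith

theorem one_sub_mul_sum_pow_half (z : ℝ) (M : ℕ) :
    (1 - z) * ∑ j ∈ Finset.range (2 * M + 1), z ^ ⌈(j : ℝ) / 2⌉₊ = 1 + z - 2 * z ^ (M + 1) := by
  induction M with
  | zero => simp; ring
  | succ M ih =>
    rw [show 2 * (M + 1) + 1 = 2 * M + 1 + 1 + 1 by ring, Finset.sum_range_succ,
      Finset.sum_range_succ, natCeil_half_odd, show 2 * M + 1 + 1 = 2 * (M + 1) by ring,
      natCeil_half_even, mul_add, mul_add, ih]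
    ring

/-- With q the overlap and z = (1 - q)/(1 + q), every positive power of z occurs twice, so the full
sum is q² (1 + z)/(1 - z) = q ≤ 1. Working with the finite sum multiplied by 1 - z avoids a division
that fails at q = 0. -/
theorem sum_edgeProb_le (hr1 : |r| < 1) (hs1 : |s| ≤ 1) (N : ℕ) (k : ℝ) :
    ∑ j ∈ Finset.range N, edgeProb r s j k ≤ 1 := by
  have h1 := edgeOverlap_nonneg r s k
  have h2 := edgeOverlap_le_one hr1 hs1 k
  refine (Finset.sum_le_sum_of_subset_of_nonneg (t := Finset.range (2 * N + 1))
    (Finset.range_mono (by omega)) fun j _ _ => edgeProb_nonneg hr1 hs1 j k).trans ?_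
  unfold edgeProb
  rw [← Finset.mul_sum]
  set q := edgeOverlap r s k
  set z := (1 - q) / (1 + q) with hz
  have hz0 : 0 ≤ z := div_nonneg (by linarith) (by linarith)
  have hzq : z * (1 + q) = 1 - q := div_mul_cancel₀ _ (by linarith)
  have hsum := one_sub_mul_sum_pow_half z N
  set T := ∑ j ∈ Finset.range (2 * N + 1), z ^ ⌈(j : ℝ) / 2⌉₊
  have hqT : q * T ≤ 1 := by
    have e : 2 * (q * T) = (1 + q) * ((1 - z) * T) := by linear_combination T * hzq
    rw [hsum] at e
    have : 0 ≤ z ^ (N + 1) := pow_nonneg hz0 _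
    nlinarith
  nlinarith

theorem hasDerivAt_edgeCos (hr1 : |r| < 1) (k : ℝ) :
    HasDerivAt (edgeCos r) (-(r ^ 2 * (Real.sin k * Real.cos k)) / edgeCos r k) k := by
  have h1 : HasDerivAt (fun k => 1 - r ^ 2 * Real.sin k ^ 2)
      (-(r ^ 2 * (2 * Real.sin k * Real.cos k))) k := by
    have := (((Real.hasDerivAt_sin k).pow 2).const_mul (r ^ 2)).const_sub 1
    simpa using this
  convert! h1.sqrt (one_sub_sq_mul_pos hr1 k).ne' using 1
  rw [show -(r ^ 2 * (2 * Real.sin k * Real.cos k)) =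
    2 * -(r ^ 2 * (Real.sin k * Real.cos k)) by ring, mul_div_mul_left _ _ two_ne_zero]
  rfl

/-- The derivative of the group velocity. -/
theorem hasDerivAt_cos_div_edgeCos (hr1 : |r| < 1) (k : ℝ) :
    HasDerivAt (fun k => Real.cos k / edgeCos r k)
      (-((1 - r ^ 2) * Real.sin k / edgeCos r k ^ 3)) k := by
  have hS := edgeCos_pos hr1 k
  convert! (Real.hasDerivAt_cos k).div (hasDerivAt_edgeCos hr1 k) hS.ne' using 1
  have e1 := edgeCos_sq hr1 k
  have e2 := Real.sin_sq_add_cos_sq k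
  field_simp
  linear_combination Real.sin k * e1 - Real.sin k * r ^ 2 * e2

theorem edgeVel_of_mem (r s : ℝ) {k : ℝ} (hk : k ∈ Icc 0 (Real.pi / 2)) :
    edgeVel r s k = (SignType.sign (s * r) : ℝ) * |r| * (Real.cos k / edgeCos r k) := by
  rw [edgeVel, abs_of_nonneg (Real.cos_nonneg_of_mem_Icc ⟨by linarith [hk.1, Real.pi_pos], hk.2⟩)]
  ring

theorem hasDerivAt_edgeVel (hr1 : |r| < 1) (s : ℝ) {k : ℝ} (hk : k ∈ Ioo 0 (Real.pi / 2)) :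
    HasDerivAt (edgeVel r s) ((SignType.sign (s * r) : ℝ) * |r| *
      -((1 - r ^ 2) * Real.sin k / edgeCos r k ^ 3)) k := by
  refine ((hasDerivAt_cos_div_edgeCos hr1 k).const_mul _).congr_of_eventuallyEq ?_
  filter_upwards [isOpen_Ioo.mem_nhds hk] with x hx
  exact edgeVel_of_mem r s (Ioo_subset_Icc_self hx)

theorem abs_sign_mul (hr0 : 0 < |r|) (hs0 : s ≠ 0) :
    |(SignType.sign (s * r) : ℝ)| = 1 := by
  have : s * r ≠ 0 := mul_ne_zero hs0 (abs_pos.1 hr0)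
  rcases this.lt_or_gt with h | h
  · simp [sign_neg h]
  · simp [sign_pos h]

theorem strictAntiOn_cos_div_edgeCos (hr1 : |r| < 1) :
    StrictAntiOn (fun k => Real.cos k / edgeCos r k) (Icc 0 (Real.pi / 2)) := by
  refine strictAntiOn_of_deriv_neg (convex_Icc _ _) (Continuous.continuousOn
    (Real.continuous_cos.div (continuous_edgeCos r) fun k => (edgeCos_pos hr1 k).ne')) ?_
  intro k hk
  rw [interior_Icc] at hk
  rw [(hasDerivAt_cos_div_edgeCos hr1 k).deriv, neg_lt_zero]
  have := Real.sin_pos_of_pos_of_lt_pi hk.1 (by linarith [hk.2, Real.pi_pos])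
  have := edgeCos_pos hr1 k
  have := sq_lt_one_of_abs hr1
  have : 0 < 1 - r ^ 2 := by linarith
  positivity

theorem injOn_edgeVel (hr0 : 0 < |r|) (hr1 : |r| < 1) (hs0 : s ≠ 0) :
    InjOn (edgeVel r s) (Ioo 0 (Real.pi / 2)) := by
  intro x hx y hy h
  have hx' := Ioo_subset_Icc_self hx
  have hy' := Ioo_subset_Icc_self hy
  rw [edgeVel_of_mem r s hx', edgeVel_of_mem r s hy'] at h
  have hne : (SignType.sign (s * r) : ℝ) * |r| ≠ 0 := by
    refine mul_ne_zero (fun h0 => ?_) hr0.ne'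
    have := abs_sign_mul hr0 hs0
    rw [h0] at this
    simp at this
  exact (strictAntiOn_cos_div_edgeCos hr1).injOn hx' hy' (mul_left_cancel₀ hne h)

/-- By the intermediate value theorem a quarter period of momenta covers the open interval between 0
and the extreme velocity ±|r|. At y = 0 the factor y² vanishes, and for |y| ≥ |r| the Konno density
does. -/
theorem g_eq_zero_of_notMem_image (hr0 : 0 < |r|) (hr1 : |r| < 1) (j : ℕ) {y : ℝ}
    (hy : y ∉ edgeVel r s '' Ioo 0 (Real.pi / 2)) : g r s j y = 0 := by
  by_contra hg
  apply hy
  have hmem : y ∈ halfLine r s := by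
    by_contra h
    exact hg (indicator_of_notMem h _)
  rw [g, indicator_of_mem hmem] at hg
  have hy0 : y ≠ 0 := by
    rintro rfl
    simp at hg
  have hyr : y ∈ Ioo (-|r|) |r| := by
    by_contra h
    rw [konnoDensity, indicator_of_notMem h] at hg
    simp at hg
  have hcont : ContinuousOn (fun k => Real.cos k / edgeCos r k) (Icc 0 (Real.pi / 2)) :=
    (Real.continuous_cos.div (continuous_edgeCos r) fun k => (edgeCos_pos hr1 k).ne').continuousOn
  have hivt := intermediate_value_Ioo' (by positivity : (0 : ℝ) ≤ Real.pi / 2) hcont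
  have h0 : edgeCos r 0 = 1 := by simp [edgeCos]
  simp only [Real.cos_pi_div_two, zero_div, Real.cos_zero, h0, div_one] at hivt
  obtain ⟨k, hk, hky⟩ := hivt (show |y| / |r| ∈ Ioo 0 1 from
    ⟨div_pos (abs_pos.2 hy0) hr0, (div_lt_one hr0).2 (abs_lt.2 hyr)⟩)
  refine ⟨k, hk, ?_⟩
  simp only at hky
  rw [edgeVel_of_mem r s (Ioo_subset_Icc_self hk), hky, mul_assoc, mul_div_cancel₀ _ hr0.ne']
  rcases hmem with ⟨h1, h2⟩ | ⟨h1, h2⟩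
  · rw [sign_pos h1, abs_of_nonneg h2]; simp
  · rw [sign_neg h1, abs_of_nonpos h2]; simp

theorem abs_edgeVel (hr0 : 0 < |r|) (hs0 : s ≠ 0) (k : ℝ) :
    |edgeVel r s k| = |r| * |Real.cos k| / edgeCos r k := by
  rw [edgeVel, abs_mul, abs_sign_mul hr0 hs0, one_mul, abs_of_nonneg]
  unfold edgeCos
  positivity

theorem edgeVel_mem_halfLine (hr0 : 0 < |r|) (hs0 : s ≠ 0) (k : ℝ) :
    edgeVel r s k ∈ halfLine r s := by
  have hnn : 0 ≤ |r| * |Real.cos k| / edgeCos r k := by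
    unfold edgeCos
    positivity
  have : s * r ≠ 0 := mul_ne_zero hs0 (abs_pos.1 hr0)
  rcases this.lt_or_gt with h | h
  · right
    rw [edgeVel, sign_neg h]
    refine ⟨h, ?_⟩
    simpa using hnn
  · left
    rw [edgeVel, sign_pos h]
    refine ⟨h, ?_⟩
    simpa using hnn

/-- With S = `edgeCos`, 1 - v² = (1 - r²)/S² and r² - v² = r² (1 - r²) sin² k / S². The Jacobian
thus cancels the Konno density, while ζ(v) becomes (1 - q)/(1 + q) for the overlap q. -/
theorem abs_deriv_mul_g_edgeVel (hr0 : 0 < |r|) (hr1 : |r| < 1) (hs0 : s ≠ 0) (j : ℕ) {k : ℝ}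
    (hk : k ∈ Ioo 0 (Real.pi / 2)) :
    |(SignType.sign (s * r) : ℝ) * |r| * -((1 - r ^ 2) * Real.sin k / edgeCos r k ^ 3)| *
      g r s j (edgeVel r s k) = 2 / Real.pi * edgeProb r s j k := by
  have hsin := Real.sin_pos_of_pos_of_lt_pi hk.1 (by linarith [hk.2, Real.pi_pos])
  have hcos := Real.cos_pos_of_mem_Ioo (x := k) ⟨by linarith [hk.1, Real.pi_pos], hk.2⟩
  have hS := edgeCos_pos hr1 k
  have hS2 := edgeCos_sq hr1 k
  have hsc := Real.sin_sq_add_cos_sq k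
  have hr2 : 0 < 1 - r ^ 2 := by linarith [sq_lt_one_of_abs hr1]
  have hv := abs_edgeVel hr0 hs0 k
  rw [abs_of_pos hcos] at hv
  have hv2 : edgeVel r s k ^ 2 = r ^ 2 * Real.cos k ^ 2 / edgeCos r k ^ 2 := by
    rw [← sq_abs, hv, div_pow, mul_pow, sq_abs]
  have e1 : 1 - edgeVel r s k ^ 2 = (1 - r ^ 2) / edgeCos r k ^ 2 := by
    rw [hv2]
    field_simp
    linear_combination hS2 - r ^ 2 * hsc
  have e2 : |r| ^ 2 - edgeVel r s k ^ 2 =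
      (|r| * √(1 - r ^ 2) * Real.sin k / edgeCos r k) ^ 2 := by
    rw [hv2, div_pow, mul_pow, mul_pow, Real.sq_sqrt hr2.le, sq_abs]
    field_simp
    linear_combination r ^ 2 * (hS2 - hsc)
  have e3 : √(|r| ^ 2 - edgeVel r s k ^ 2) = |r| * √(1 - r ^ 2) * Real.sin k / edgeCos r k := by
    rw [e2, Real.sqrt_sq (by positivity)]
  have hlt : edgeVel r s k ∈ Ioo (-|r|) |r| := by
    have hpos : 0 < (|r| * √(1 - r ^ 2) * Real.sin k / edgeCos r k) ^ 2 := by positivity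
    have : edgeVel r s k ^ 2 < |r| ^ 2 := by linarith
    rw [sq_lt_sq, abs_abs] at this
    exact abs_lt.1 this
  have hz : zeta r s (edgeVel r s k) = (1 - edgeOverlap r s k) / (1 + edgeOverlap r s k) := by
    rw [zeta, hv, edgeOverlap, abs_of_pos hcos]
    have : 0 < edgeCos r k + |s| * Real.cos k := by positivity
    have : 0 < 1 + |s| * Real.cos k / edgeCos r k := by positivity
    have : 0 < |r| + |s| * (|r| * Real.cos k / edgeCos r k) := by positivity
    rw [div_eq_div_iff (by positivity) (by positivity)]
    field_simp
  rw [g, indicator_of_mem (edgeVel_mem_halfLine hr0 hs0 k), hz, edgeProb, konnoDensity,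
    indicator_of_mem hlt, e1, e3, hv2, abs_mul, abs_mul, abs_sign_mul hr0 hs0, abs_abs, abs_neg,
    abs_of_pos (by positivity : 0 < (1 - r ^ 2) * Real.sin k / edgeCos r k ^ 3), sq_abs,
    edgeOverlap, abs_of_pos hcos]
  have hsq : 0 < √(1 - r ^ 2) := Real.sqrt_pos.2 hr2
  have hrne : r ≠ 0 := abs_pos.1 hr0
  generalize ((1 - |s| * Real.cos k / edgeCos r k) /
    (1 + |s| * Real.cos k / edgeCos r k)) ^ ⌈(j : ℝ) / 2⌉₊ = Z
  rw [div_pow, mul_pow, sq_abs]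
  field_simp

/-- Nonnegativity of ζ on |y| < |r| uses |s| ≤ 1: then |s||y| ≤ |y| < |r|. -/
theorem g_nonneg (hr1 : |r| < 1) (hs1 : |s| ≤ 1) (j : ℕ) (y : ℝ) : 0 ≤ g r s j y := by
  refine indicator_nonneg (fun y _ => ?_) y
  by_cases hy : y ∈ Ioo (-|r|) |r|
  · have hy' : |y| < |r| := abs_lt.2 hy
    have hy1 : 0 < 1 - y ^ 2 := by
      rw [← sq_abs]
      nlinarith [abs_nonneg y]
    have hz : 0 ≤ zeta r s y := by
      refine div_nonneg ?_ (by positivity)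
      nlinarith [abs_nonneg y]
    rw [konnoDensity, indicator_of_mem hy]
    have := Real.pi_pos
    positivity
  · rw [konnoDensity, indicator_of_notMem hy]
    simp

theorem integrableOn_edgeProb (hr1 : |r| < 1) (s : ℝ) (j : ℕ) :
    IntegrableOn (edgeProb r s j) (Ioo 0 (Real.pi / 2)) :=
  ((continuous_edgeProb hr1 s j).integrableOn_Icc).mono_set Ioo_subset_Icc_self

theorem integrable_g (hr0 : 0 < |r|) (hr1 : |r| < 1) (hs0 : s ≠ 0) (j : ℕ) :
    Integrable (g r s j) := by
  have hsupp : Function.support (g r s j) ⊆ edgeVel r s '' Ioo 0 (Real.pi / 2) := by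
    intro y hy
    by_contra h
    exact hy (g_eq_zero_of_notMem_image hr0 hr1 j h)
  rw [← integrableOn_iff_integrable_of_support_subset hsupp,
    integrableOn_image_iff_integrableOn_abs_deriv_smul measurableSet_Ioo
      (fun k hk => (hasDerivAt_edgeVel hr1 s hk).hasDerivWithinAt) (injOn_edgeVel hr0 hr1 hs0)]
  have := Integrable.const_mul (integrableOn_edgeProb hr1 s j) (2 / Real.pi)
  refine IntegrableOn.congr_fun this
    (fun k hk => ?_) measurableSet_Ioo
  exact (abs_deriv_mul_g_edgeVel hr0 hr1 hs0 j hk).symm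

/-- The change of variables from the velocity to the momentum. -/
theorem integral_g_smul {E : Type*} [NormedAddCommGroup E] [NormedSpace ℝ E]
    (hr0 : 0 < |r|) (hr1 : |r| < 1) (hs0 : s ≠ 0) (j : ℕ) (F : ℝ → E) :
    ∫ y, g r s j y • F y = (2 / Real.pi) •
      ∫ k in Ioo 0 (Real.pi / 2), edgeProb r s j k • F (edgeVel r s k) := by
  rw [← setIntegral_eq_integral_of_forall_compl_eq_zero
    (s := edgeVel r s '' Ioo 0 (Real.pi / 2)) (fun y hy => by
      rw [g_eq_zero_of_notMem_image hr0 hr1 j hy, zero_smul]),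
    integral_image_eq_integral_abs_deriv_smul measurableSet_Ioo
      (fun k hk => (hasDerivAt_edgeVel hr1 s hk).hasDerivWithinAt) (injOn_edgeVel hr0 hr1 hs0),
    ← integral_smul]
  refine setIntegral_congr_fun measurableSet_Ioo fun k hk => ?_
  rw [smul_smul, smul_smul, abs_deriv_mul_g_edgeVel hr0 hr1 hs0 j hk]

theorem integral_g (hr0 : 0 < |r|) (hr1 : |r| < 1) (hs0 : s ≠ 0) (j : ℕ) :
    ∫ y, g r s j y = 2 / Real.pi * ∫ k in Ioo 0 (Real.pi / 2), edgeProb r s j k := by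
  simpa using integral_g_smul hr0 hr1 hs0 j (fun _ => (1 : ℝ))

theorem sum_integral_g_le (hr0 : 0 < |r|) (hr1 : |r| < 1) (hs0 : s ≠ 0) (hs1 : |s| ≤ 1)
    (N : ℕ) : ∑ j ∈ Finset.range N, ∫ y, g r s j y ≤ 1 := by
  simp only [integral_g hr0 hr1 hs0]
  rw [← Finset.mul_sum, ← integral_finsetSum _ fun j _ => integrableOn_edgeProb hr1 s j]
  have h : ∫ k in Ioo 0 (Real.pi / 2), ∑ j ∈ Finset.range N, edgeProb r s j k ≤
      ∫ _ in Ioo 0 (Real.pi / 2), (1 : ℝ) :=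
    integral_mono (integrable_finsetSum _ fun j _ => integrableOn_edgeProb hr1 s j)
      (integrable_const _) fun k => sum_edgeProb_le hr1 hs1 N k
  have hpi := Real.pi_pos
  have h1 : ∫ _ in Ioo 0 (Real.pi / 2), (1 : ℝ) = Real.pi / 2 := by
    simp
    positivity
  rw [h1] at h
  calc 2 / Real.pi * _ ≤ 2 / Real.pi * (Real.pi / 2) := by gcongr
    _ = 1 := by field_simp

theorem tsum_lintegral_g_le (hr0 : 0 < |r|) (hr1 : |r| < 1) (hs0 : s ≠ 0) (hs1 : |s| ≤ 1) :
    ∑' j : ℕ, ∫⁻ y, ENNReal.ofReal (g r s j y) ≤ 1 := by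
  have hj : ∀ j, ∫⁻ y, ENNReal.ofReal (g r s j y) = ENNReal.ofReal (∫ y, g r s j y) := fun j =>
    (ofReal_integral_eq_lintegral_ofReal (integrable_g hr0 hr1 hs0 j)
      (Eventually.of_forall fun y => g_nonneg hr1 hs1 j y)).symm
  simp only [hj]
  refine ENNReal.tsum_le_of_sum_range_le fun N => ?_
  rw [← ENNReal.ofReal_sum_of_nonneg fun j _ => integral_nonneg (g_nonneg hr1 hs1 j)]
  exact ENNReal.ofReal_le_one.2 (sum_integral_g_le hr0 hr1 hs0 hs1 N)

/-- Folding the full circle of momenta onto a quarter. -/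
theorem integral_circle_eq_four_mul {E : Type*} [NormedAddCommGroup E] [NormedSpace ℝ E]
    {H : ℝ → E} (hH : Continuous H) (h1 : ∀ k, H (-k) = H k) (h2 : ∀ k, H (Real.pi - k) = H k) :
    ∫ k in -Real.pi..Real.pi, H k = (4 : ℝ) • ∫ k in Ioo 0 (Real.pi / 2), H k := by
  have hi : ∀ a b, IntervalIntegrable H volume a b := fun a b => hH.intervalIntegrable a b
  have a1 : ∫ k in -Real.pi..0, H k = ∫ k in (0 : ℝ)..Real.pi, H k := by
    have := intervalIntegral.integral_comp_neg (a := 0) (b := Real.pi) H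
    rw [neg_zero] at this
    rw [← this]
    simp only [h1]
  have a2 : ∫ k in (Real.pi / 2)..Real.pi, H k = ∫ k in (0 : ℝ)..(Real.pi / 2), H k := by
    have := intervalIntegral.integral_comp_sub_left (a := 0) (b := Real.pi / 2) H Real.pi
    rw [sub_zero, show Real.pi - Real.pi / 2 = Real.pi / 2 by ring] at this
    rw [← this]
    simp only [h2]
  rw [← intervalIntegral.integral_add_adjacent_intervals (hi (-Real.pi) 0) (hi 0 Real.pi), a1,
    ← intervalIntegral.integral_add_adjacent_intervals (hi 0 (Real.pi / 2))
      (hi (Real.pi / 2) Real.pi), a2, intervalIntegral.integral_of_le (by positivity),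
    integral_Ioc_eq_integral_Ioo]
  module

theorem integral_g_smul_eq_circle {E : Type*} [NormedAddCommGroup E] [NormedSpace ℝ E]
    (hr0 : 0 < |r|) (hr1 : |r| < 1) (hs0 : s ≠ 0) (j : ℕ) {F : ℝ → E} (hF : Continuous F) :
    ∫ y, g r s j y • F y = (2 * Real.pi)⁻¹ •
      ∫ k in -Real.pi..Real.pi, edgeProb r s j k • F (edgeVel r s k) := by
  rw [integral_g_smul hr0 hr1 hs0, integral_circle_eq_four_mul
    (H := fun k => edgeProb r s j k • F (edgeVel r s k)) ((continuous_edgeProb hr1 s j).smul (hF.comp (continuous_edgeVel hr1 s))), smul_smul]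
  -- The four quarters of the circle turn the normalisation 1/(2π) into 2/π.
  · congr 1
    have := Real.pi_pos
    field_simp
    norm_num
  · intro k
    simp [edgeProb, edgeVel, edgeOverlap, edgeCos]
  · intro k
    simp [edgeProb, edgeVel, edgeOverlap, edgeCos]

theorem zeta_mem_Ioo (hs0 : s ≠ 0) (hs1 : |s| ≤ 1) {y : ℝ} (hy0 : 0 < |y|) (hy : |y| < |r|) :
    0 < zeta r s y ∧ zeta r s y < 1 := by
  have hs := abs_pos.2 hs0
  have hsy : 0 < |s| * |y| := mul_pos hs hy0
  have hden : 0 < |r| + |s| * |y| := by positivity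
  constructor
  · exact div_pos (by nlinarith) hden
  · rw [zeta, div_lt_one hden]
    linarith

theorem g_eq_zeta_pow_mul (r s : ℝ) (j : ℕ) (y : ℝ) :
    g r s j y = zeta r s y ^ ⌈(j : ℝ) / 2⌉₊ * g r s 0 y := by
  by_cases hy : y ∈ halfLine r s
  · simp [g, hy]
    ring
  · simp [g, hy]

end

/-! ### The walk in momentum space -/

/-- The coin entry `coinA` at momentum `k`. -/
def momA (α β k : ℝ) : ℂ := coinA α β (Complex.exp (k * Complex.I))

/-- The coin entry `coinB` at momentum `k`. -/
def momB (α β k : ℝ) : ℂ := coinB α β (Complex.exp (k * Complex.I))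

theorem inv_exp_mul_I (k : ℝ) :
    (Complex.exp (k * Complex.I))⁻¹ = Real.cos k - Real.sin k * Complex.I := by
  rw [← Complex.exp_neg, ← neg_mul, Complex.exp_mul_I, Complex.cos_neg, Complex.sin_neg]
  push_cast
  ring

theorem momA_eq (α β k : ℝ) : momA α β k =
    ((Real.cos (α + β) * Real.cos k : ℝ) : ℂ)
      + ((-(Real.cos (α - β) * Real.sin k) : ℝ) : ℂ) * Complex.I := by
  rw [momA, coinA, inv_exp_mul_I, Complex.exp_mul_I, Real.cos_add, Real.cos_sub]
  push_cast
  ring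

theorem momB_eq (α β k : ℝ) : momB α β k =
    ((-(Real.sin (α + β) * Real.cos k) : ℝ) : ℂ)
      + ((-(Real.sin (α - β) * Real.sin k) : ℝ) : ℂ) * Complex.I := by
  rw [momB, coinB, inv_exp_mul_I, Complex.exp_mul_I, Real.sin_add, Real.sin_sub]
  push_cast
  ring

theorem re_add_mul_I (a b : ℝ) : ((a : ℂ) + (b : ℂ) * Complex.I).re = a := by
  simp

theorem im_add_mul_I (a b : ℝ) : ((a : ℂ) + (b : ℂ) * Complex.I).im = b := by
  simp

theorem momB_re (α β k : ℝ) : (momB α β k).re = -(Real.sin (α + β) * Real.cos k) := by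
  rw [momB_eq, re_add_mul_I]

theorem momB_im (α β k : ℝ) : (momB α β k).im = -(Real.sin (α - β) * Real.sin k) := by
  rw [momB_eq, im_add_mul_I]

theorem normSq_momA_add (α β k : ℝ) :
    Complex.normSq (momA α β k) + Complex.normSq (momB α β k) = 1 := by
  rw [momA_eq, momB_eq, Complex.normSq_add_mul_I, Complex.normSq_add_mul_I]
  have h1 := Real.sin_sq_add_cos_sq (α + β)
  have h2 := Real.sin_sq_add_cos_sq (α - β)
  have h3 := Real.sin_sq_add_cos_sq k
  linear_combination Real.cos k ^ 2 * h1 + Real.sin k ^ 2 * h2 + h3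

theorem momA_ne_zero {α β k : ℝ} (hr1 : |Real.sin (α - β)| < 1) (hk : Real.sin k ≠ 0) :
    momA α β k ≠ 0 := by
  intro h
  have := congrArg Complex.im h
  rw [momA_eq, im_add_mul_I, Complex.zero_im, neg_eq_zero] at this
  rcases mul_eq_zero.1 this with h | h
  · have h1 := Real.sin_sq_add_cos_sq (α - β)
    rw [h] at h1
    have := sq_lt_one_of_abs hr1
    linarith
  · exact hk h

theorem sqrt_one_sub_momB_im (α β k : ℝ) :
    √(1 - (momB α β k).im ^ 2) = edgeCos (Real.sin (α - β)) k := by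
  rw [momB_im, edgeCos, neg_sq, mul_pow]

theorem edgeWeight_momB (α β k : ℝ) :
    edgeWeight (momB α β k) = edgeOverlap (Real.sin (α - β)) (Real.sin (α + β)) k := by
  rw [edgeWeight, sqrt_one_sub_momB_im, momB_re, abs_neg, abs_mul, edgeOverlap]

theorem edgePhase_momB (α β k : ℝ) : edgePhase (momB α β k) =
    (((SignType.sign (-(Real.sin (α + β) * Real.cos k)) : ℝ) *
      edgeCos (Real.sin (α - β)) k : ℝ) : ℂ)
      + ((-(Real.sin (α - β) * Real.sin k) : ℝ) : ℂ) * Complex.I := by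
  rw [edgePhase, sqrt_one_sub_momB_im, momB_re, momB_im]

theorem sign_sq_eq_one {x : ℝ} (hx : x ≠ 0) : (SignType.sign x : ℝ) ^ 2 = 1 := by
  rcases hx.lt_or_gt with h | h
  · simp [sign_neg h]
  · simp [sign_pos h]

theorem norm_edgePhase_momB {α β k : ℝ} (hr1 : |Real.sin (α - β)| < 1)
    (hs0 : Real.sin (α + β) ≠ 0) (hk : Real.cos k ≠ 0) : ‖edgePhase (momB α β k)‖ = 1 := by
  have : Complex.normSq (edgePhase (momB α β k)) = 1 := by
    rw [edgePhase_momB, Complex.normSq_add_mul_I, mul_pow,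
      sign_sq_eq_one (neg_ne_zero.2 (mul_ne_zero hs0 hk)), edgeCos_sq hr1]
    ring
  rw [Complex.normSq_eq_norm_sq] at this
  nlinarith [norm_nonneg (edgePhase (momB α β k))]

/-- λ and B have the same imaginary part, and the real part of λ has the sign of Re B, so |λ - B| =
S - |Re B|. Unitarity gives |A|² = S² - |Re B|², and one factor cancels in the quotient. -/
theorem normSq_edgeDecay {α β k : ℝ} (hr1 : |Real.sin (α - β)| < 1)
    (hs0 : Real.sin (α + β) ≠ 0) (hk : Real.cos k ≠ 0) (hA : momA α β k ≠ 0) :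
    Complex.normSq (edgeDecay (momA α β k) (momB α β k)) =
      (1 - edgeOverlap (Real.sin (α - β)) (Real.sin (α + β)) k) /
        (1 + edgeOverlap (Real.sin (α - β)) (Real.sin (α + β)) k) := by
  have hS := edgeCos_pos hr1 k
  have hS2 := edgeCos_sq hr1 k
  have hApos := Complex.normSq_pos.2 hA
  have hne : -(Real.sin (α + β) * Real.cos k) ≠ 0 := neg_ne_zero.2 (mul_ne_zero hs0 hk)
  have hA2 : Complex.normSq (momA α β k) =
      edgeCos (Real.sin (α - β)) k ^ 2 - (|Real.sin (α + β)| * |Real.cos k|) ^ 2 := by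
    have h1 := normSq_momA_add α β k
    rw [momB_eq, Complex.normSq_add_mul_I] at h1
    rw [hS2, mul_pow, sq_abs, sq_abs]
    linear_combination h1
  have hnum : Complex.normSq (edgePhase (momB α β k) - momB α β k) =
      (edgeCos (Real.sin (α - β)) k - |Real.sin (α + β)| * |Real.cos k|) ^ 2 := by
    rw [edgePhase_momB, momB_eq, add_sub_add_right_eq_sub, ← Complex.ofReal_sub,
      Complex.normSq_ofReal, ← abs_mul, ← abs_neg (Real.sin (α + β) * Real.cos k)]
    rcases hne.lt_or_gt with h | h
    · rw [sign_neg h, abs_of_neg h]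
      simp only [SignType.coe_neg_one]
      ring
    · rw [sign_pos h, abs_of_pos h]
      simp only [SignType.coe_one]
      ring
  rw [edgeDecay, Complex.normSq_div, hnum, edgeOverlap, hA2]
  rw [hA2] at hApos
  have hp : 0 < edgeCos (Real.sin (α - β)) k + |Real.sin (α + β)| * |Real.cos k| := by positivity
  have hp' : 0 < 1 + |Real.sin (α + β)| * |Real.cos k| / edgeCos (Real.sin (α - β)) k := by
    positivity
  rw [div_eq_div_iff hApos.ne' hp'.ne']
  field_simp
  ring

/-- The amplitude of the `j`-th horizontal arc at momentum `k`. -/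
def momAmp (α β : ℝ) (n j : ℕ) (k : ℝ) : ℂ :=
  if Even j then (halfLineWalk (momA α β k) (momB α β k) n (j / 2)).2
  else (halfLineWalk (momA α β k) (momB α β k) n (j / 2)).1

/-- The contribution of the edge state to `momAmp`. -/
def edgeAmp (α β : ℝ) (n j : ℕ) (k : ℝ) : ℂ :=
  edgeWeight (momB α β k) * edgePhase (momB α β k) ^ n *
    edgeDecay (momA α β k) (momB α β k) ^ ⌈(j : ℝ) / 2⌉₊

/-- At site i the right-moving amplitude carries the i-th power of the decay rate and the
left-moving one the (i+1)-st; the ceiling of j/2 encodes both. -/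
theorem natCeil_half (j : ℕ) : ⌈(j : ℝ) / 2⌉₊ = if Even j then j / 2 else j / 2 + 1 := by
  rcases Nat.even_or_odd' j with ⟨i, rfl | rfl⟩
  · rw [natCeil_half_even, if_pos (even_two_mul i)]
    omega
  · rw [natCeil_half_odd, if_neg (by simp)]
    omega

theorem tendsto_momAmp_sub_edgeAmp {α β k : ℝ} (hr1 : |Real.sin (α - β)| < 1)
    (hs0 : Real.sin (α + β) ≠ 0) (hk : Real.cos k ≠ 0) (hk' : Real.sin k ≠ 0) (j : ℕ) :
    Tendsto (fun n => momAmp α β n j k - edgeAmp α β n j k) atTop (𝓝 0) := by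
  have h := tendsto_halfLineWalk (momA_ne_zero hr1 hk') (normSq_momA_add α β k)
    (by rw [momB_re]; exact neg_ne_zero.2 (mul_ne_zero hs0 hk)) (j / 2)
  unfold momAmp edgeAmp
  rw [natCeil_half]
  split_ifs
  · exact h.1
  · exact h.2

theorem norm_momAmp_le (α β : ℝ) (n j : ℕ) (k : ℝ) : ‖momAmp α β n j k‖ ≤ 1 := by
  unfold momAmp
  split_ifs
  · exact norm_halfLineWalk_snd_le (normSq_momA_add α β k) _ _
  · exact norm_halfLineWalk_fst_le (normSq_momA_add α β k) _ _

/-- Holds at every momentum, including the degenerate ones, so that it can serve as a dominating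
bound. -/
theorem norm_edgeAmp_le {α β : ℝ} (hr1 : |Real.sin (α - β)| < 1) (hs0 : Real.sin (α + β) ≠ 0)
    (n j : ℕ) (k : ℝ) : ‖edgeAmp α β n j k‖ ≤ 1 := by
  have hq0 := edgeOverlap_nonneg (Real.sin (α - β)) (Real.sin (α + β)) k
  have hq1 := edgeOverlap_le_one hr1 (Real.abs_sin_le_one (α + β)) k
  unfold edgeAmp
  rw [edgeWeight_momB]
  by_cases hk : Real.cos k = 0
  · simp [edgeOverlap, hk]
  rw [norm_mul, norm_mul, norm_pow, norm_pow, norm_edgePhase_momB hr1 hs0 hk, one_pow, mul_one,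
    Complex.norm_real, Real.norm_of_nonneg hq0]
  refine mul_le_one₀ hq1 (by positivity) (pow_le_one₀ (norm_nonneg _) ?_)
  -- If A = 0, the quotient defining `edgeDecay` is 0 by the convention for division by zero.
  by_cases hA : momA α β k = 0
  · simp [edgeDecay, hA]
  have hd := normSq_edgeDecay hr1 hs0 hk hA
  rw [Complex.normSq_eq_norm_sq] at hd
  have : (1 - edgeOverlap (Real.sin (α - β)) (Real.sin (α + β)) k) /
        (1 + edgeOverlap (Real.sin (α - β)) (Real.sin (α + β)) k) ≤ 1 :=
    div_le_one_of_le₀ (by linarith) (by linarith)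
  rw [← hd] at this
  exact (sq_le_one_iff₀ (norm_nonneg _)).1 this

theorem momAmp_periodic (α β : ℝ) (n j : ℕ) : Function.Periodic (momAmp α β n j) (2 * Real.pi) := by
  intro k
  simp [momAmp, momA_eq, momB_eq, Real.cos_add_two_pi, Real.sin_add_two_pi]

theorem edgeAmp_periodic (α β : ℝ) (n j : ℕ) : Function.Periodic (edgeAmp α β n j) (2 * Real.pi) := by
  intro k
  simp [edgeAmp, momA_eq, momB_eq, Real.cos_add_two_pi, Real.sin_add_two_pi]

theorem sign_eq_div_abs (x : ℝ) : (SignType.sign x : ℝ) = x / |x| := by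
  rcases lt_trichotomy x 0 with h | h | h
  · rw [sign_neg h, abs_of_neg h, div_neg, div_self h.ne]; simp
  · simp [h]
  · rw [sign_pos h, abs_of_pos h, div_self h.ne']; simp

theorem measurable_edgeAmp (α β : ℝ) (n j : ℕ) : Measurable (edgeAmp α β n j) := by
  have hA : Measurable (momA α β) := by
    simp only [funext (momA_eq α β)]
    fun_prop
  have hB : Measurable (momB α β) := by
    simp only [funext (momB_eq α β)]
    fun_prop
  have hW : Measurable fun k => edgeWeight (momB α β k) := by
    unfold edgeWeight
    fun_prop
  have hP : Measurable fun k => edgePhase (momB α β k) := by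
    unfold edgePhase
    -- Written as x / |x|, also correct at 0 since 0 / 0 = 0, the sign is visibly measurable.
    simp only [sign_eq_div_abs]
    fun_prop
  unfold edgeAmp edgeDecay
  fun_prop

/-! ### Fourier inversion -/

theorem psi_horizontal_eq_zero (α β : ℝ) (n j : ℕ) {m : ℤ} (hm : m ∉ Finset.Icc (-n : ℤ) n) :
    psi α β n ((j / 2, m), if Even j then 1 else 0) = 0 := by
  have hm' : (n : ℤ) < |m| := by
    rw [Finset.mem_Icc, ← abs_le] at hm
    exact not_le.1 hm
  by_cases hj : Even j
  · rw [if_pos hj]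
    exact (psi_eq_zero α β n _ m hm').2
  · rw [if_neg hj]
    exact (psi_eq_zero α β n _ m hm').1

theorem nu_eq_zero (α β : ℝ) (n j : ℕ) {m : ℤ} (hm : m ∉ Finset.Icc (-n : ℤ) n) :
    nu α β n j m = 0 := by
  rw [nu, psi_horizontal_eq_zero α β n j hm, norm_zero, sq, zero_mul]

theorem hasSum_momAmp (α β : ℝ) (n j : ℕ) (k : ℝ) :
    HasSum (fun m : ℤ => psi α β n ((j / 2, m), if Even j then 1 else 0) *
      Complex.exp (k * Complex.I) ^ m) (momAmp α β n j k) := by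
  have h := hasSum_psi α β (Complex.norm_exp_ofReal_mul_I k) n (j / 2)
  unfold momAmp
  by_cases hj : Even j
  · simp only [if_pos hj]
    exact h.2
  · simp only [if_neg hj]
    exact h.1

theorem momAmp_eq_sum (α β : ℝ) (n j : ℕ) (k : ℝ) : momAmp α β n j k =
    ∑ m ∈ Finset.Icc (-n : ℤ) n, psi α β n ((j / 2, m), if Even j then 1 else 0) *
      Complex.exp (m * k * Complex.I) := by
  rw [← (hasSum_momAmp α β n j k).tsum_eq, tsum_eq_sum fun m hm => by
    rw [psi_horizontal_eq_zero α β n j hm, zero_mul]]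
  refine Finset.sum_congr rfl fun m _ => ?_
  rw [← Complex.exp_int_mul, mul_assoc]

theorem continuous_momAmp (α β : ℝ) (n j : ℕ) : Continuous (momAmp α β n j) := by
  simp only [funext (momAmp_eq_sum α β n j)]
  fun_prop

theorem integral_exp_int_mul (m : ℤ) :
    ∫ k in -Real.pi..Real.pi, Complex.exp (m * k * Complex.I) =
      if m = 0 then 2 * (Real.pi : ℂ) else 0 := by
  split_ifs with h
  · simp [h]
    ring
  · have hc : (m * Complex.I : ℂ) ≠ 0 := mul_ne_zero (by exact_mod_cast h) Complex.I_ne_zero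
    have := integral_exp_mul_complex (a := -Real.pi) (b := Real.pi) hc
    simp only [mul_right_comm _ Complex.I] at this
    rw [this]
    have hper : Complex.exp (m * (Real.pi : ℝ) * Complex.I) =
        Complex.exp (m * ((-Real.pi : ℝ) : ℂ) * Complex.I) := by
      rw [Complex.exp_eq_exp_iff_exists_int]
      refine ⟨m, ?_⟩
      push_cast
      ring
    rw [hper, sub_self, zero_div]

/-- The autocorrelation of a trigonometric polynomial. -/
theorem integral_conj_mul_translate (S : Finset ℤ) (c : ℤ → ℂ) (τ : ℝ) {f : ℝ → ℂ}
    (hf : ∀ k, f k = ∑ m ∈ S, c m * Complex.exp (m * k * Complex.I)) :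
    ∫ k in -Real.pi..Real.pi, star (f k) * f (k + τ) =
      2 * (Real.pi : ℂ) * ∑ m ∈ S, ((‖c m‖ ^ 2 : ℝ) : ℂ) * Complex.exp (m * τ * Complex.I) := by
  have hexp : ∀ k : ℝ, star (f k) * f (k + τ) = ∑ m ∈ S, ∑ l ∈ S,
      (star (c m) * (c l * Complex.exp (l * τ * Complex.I))) *
        Complex.exp (((l - m : ℤ) : ℂ) * k * Complex.I) := by
    intro k
    rw [hf, hf, star_sum, Finset.sum_mul_sum]
    refine Finset.sum_congr rfl fun m _ => Finset.sum_congr rfl fun l _ => ?_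
    have e1 : star (Complex.exp (m * k * Complex.I)) = Complex.exp (-(m * k * Complex.I)) := by
      rw [Complex.star_def, ← Complex.exp_conj]
      simp
    have e2 : Complex.exp (l * ((k + τ : ℝ) : ℂ) * Complex.I) =
        Complex.exp (l * τ * Complex.I) * Complex.exp (l * k * Complex.I) := by
      rw [← Complex.exp_add]
      push_cast
      ring_nf
    have e3 : Complex.exp (((l - m : ℤ) : ℂ) * k * Complex.I) =
        Complex.exp (l * k * Complex.I) * Complex.exp (-(m * k * Complex.I)) := by
      rw [← Complex.exp_add]
      push_cast
      ring_nf
    rw [star_mul', e1, e2, e3]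
    ring
  simp only [hexp]
  have hint : ∀ (d : ℂ) (p : ℤ), IntervalIntegrable
      (fun k : ℝ => d * Complex.exp ((p : ℂ) * k * Complex.I)) volume (-Real.pi) Real.pi :=
    fun d p => Continuous.intervalIntegrable (by fun_prop) _ _
  rw [intervalIntegral.integral_finsetSum fun m _ => by
    refine Continuous.intervalIntegrable ?_ _ _
    fun_prop, Finset.mul_sum]
  refine Finset.sum_congr rfl fun m hm => ?_
  rw [intervalIntegral.integral_finsetSum fun l _ => hint _ _]
  simp only [intervalIntegral.integral_const_mul, integral_exp_int_mul]
  rw [Finset.sum_eq_single m]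
  · have : star (c m) * c m = ((‖c m‖ ^ 2 : ℝ) : ℂ) := by
      rw [← Complex.normSq_eq_norm_sq, mul_comm]
      exact Complex.mul_conj _
    rw [← this, sub_self, if_pos rfl]
    ring
  · intro l _ hlm
    rw [if_neg (sub_ne_zero.2 hlm), mul_zero]
  · exact fun h => absurd hm h

theorem sum_nu_mul_exp (α β : ℝ) (n j : ℕ) (τ : ℝ) :
    2 * (Real.pi : ℂ) * ∑ m ∈ Finset.Icc (-n : ℤ) n,
      (nu α β n j m : ℂ) * Complex.exp (m * τ * Complex.I) =
    ∫ k in -Real.pi..Real.pi, star (momAmp α β n j k) * momAmp α β n j (k + τ) :=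
  (integral_conj_mul_translate _ _ τ (momAmp_eq_sum α β n j)).symm

/-- Parseval, as the autocorrelation at τ = 0, together with the bound one on the momentum
amplitude. -/
theorem sum_nu_le_one (α β : ℝ) (n j : ℕ) :
    ∑ m ∈ Finset.Icc (-n : ℤ) n, nu α β n j m ≤ 1 := by
  have h := sum_nu_mul_exp α β n j 0
  simp only [Complex.ofReal_zero, mul_zero, zero_mul, Complex.exp_zero, mul_one, add_zero] at h
  have hle : ‖∫ k in -Real.pi..Real.pi, star (momAmp α β n j k) * momAmp α β n j k‖ ≤
      1 * |Real.pi - -Real.pi| := by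
    refine intervalIntegral.norm_integral_le_of_norm_le_const fun k _ => ?_
    rw [norm_mul, norm_star]
    exact mul_le_one₀ (norm_momAmp_le α β n j k) (norm_nonneg _) (norm_momAmp_le α β n j k)
  rw [← h, ← Complex.ofReal_sum, ← Complex.ofReal_ofNat, ← Complex.ofReal_mul,
    ← Complex.ofReal_mul, Complex.norm_real, Real.norm_eq_abs] at hle
  have hpi := Real.pi_pos
  rw [sub_neg_eq_add, abs_of_pos (by linarith : 0 < Real.pi + Real.pi)] at hle
  have := (le_abs_self _).trans hle
  nlinarith

/-! ### Asymptotics of the autocorrelation -/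

theorem ae_cos_ne_zero_and_sin_ne_zero : ∀ᵐ k : ℝ, Real.cos k ≠ 0 ∧ Real.sin k ≠ 0 := by
  have h1 : ∀ᵐ k : ℝ, k ∉ Set.range fun n : ℤ => (2 * (n : ℝ) + 1) * Real.pi / 2 :=
    (Set.countable_range _).ae_notMem volume
  have h2 : ∀ᵐ k : ℝ, k ∉ Set.range fun n : ℤ => (n : ℝ) * Real.pi :=
    (Set.countable_range _).ae_notMem volume
  filter_upwards [h1, h2] with k hk1 hk2
  refine ⟨fun h => hk1 ?_, fun h => hk2 ?_⟩
  · obtain ⟨n, hn⟩ := Real.cos_eq_zero_iff.1 h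
    exact ⟨n, hn.symm⟩
  · exact Real.sin_eq_zero_iff.1 h

theorem intervalIntegrable_of_norm_le {E : Type*} [NormedAddCommGroup E] {f : ℝ → E}
    (hf : StronglyMeasurable f) {C : ℝ} (hC : ∀ x, ‖f x‖ ≤ C) (a b : ℝ) :
    IntervalIntegrable f volume a b := by
  rw [intervalIntegrable_iff]
  exact Measure.integrableOn_of_bounded (M := C) (by simp) hf.aestronglyMeasurable
    (Eventually.of_forall hC)

section

variable {α β : ℝ}

theorem norm_momAmp_sub_edgeAmp_le (hr1 : |Real.sin (α - β)| < 1) (hs0 : Real.sin (α + β) ≠ 0)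
    (n j : ℕ) (k : ℝ) : ‖momAmp α β n j k - edgeAmp α β n j k‖ ≤ 2 := by
  refine (norm_sub_le _ _).trans ?_
  linarith [norm_momAmp_le α β n j k, norm_edgeAmp_le hr1 hs0 n j k]

theorem measurable_momAmp_sub_edgeAmp (α β : ℝ) (n j : ℕ) :
    Measurable fun k => momAmp α β n j k - edgeAmp α β n j k :=
  (continuous_momAmp α β n j).measurable.sub (measurable_edgeAmp α β n j)

theorem tendsto_integral_norm_momAmp_sub_edgeAmp (hr1 : |Real.sin (α - β)| < 1)
    (hs0 : Real.sin (α + β) ≠ 0) (j : ℕ) :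
    Tendsto (fun n => ∫ k in -Real.pi..Real.pi, ‖momAmp α β n j k - edgeAmp α β n j k‖)
      atTop (𝓝 0) := by
  have h := intervalIntegral.tendsto_integral_filter_of_dominated_convergence (μ := volume)
    (a := -Real.pi) (b := Real.pi) (l := atTop) (f := fun _ => (0 : ℝ))
    (F := fun n k => ‖momAmp α β n j k - edgeAmp α β n j k‖) (fun _ => 2)
    (Eventually.of_forall fun n =>
      (measurable_momAmp_sub_edgeAmp α β n j).norm.aestronglyMeasurable)
    (Eventually.of_forall fun n => Eventually.of_forall fun k _ => by
      rw [norm_norm]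
      exact norm_momAmp_sub_edgeAmp_le hr1 hs0 n j k)
    intervalIntegrable_const
    (by
      filter_upwards [ae_cos_ne_zero_and_sin_ne_zero] with k hk _
      exact tendsto_zero_iff_norm_tendsto_zero.1
        (tendsto_momAmp_sub_edgeAmp hr1 hs0 hk.1 hk.2 j))
  simpa using h

/-- The difference of products is split into two terms, each containing one error factor and one
factor of modulus at most one. By 2π-periodicity the shifted error has the same integral, so the
bound is uniform in τ and applies to τ = t/n. -/
theorem norm_integral_momAmp_sub_integral_edgeAmp_le (hr1 : |Real.sin (α - β)| < 1)
    (hs0 : Real.sin (α + β) ≠ 0) (n j : ℕ) (τ : ℝ) :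
    ‖(∫ k in -Real.pi..Real.pi, star (momAmp α β n j k) * momAmp α β n j (k + τ)) -
      ∫ k in -Real.pi..Real.pi, star (edgeAmp α β n j k) * edgeAmp α β n j (k + τ)‖ ≤
    2 * ∫ k in -Real.pi..Real.pi, ‖momAmp α β n j k - edgeAmp α β n j k‖ := by
  have mh := continuous_momAmp α β n j
  have me := measurable_edgeAmp α β n j
  have bh := norm_momAmp_le α β n j
  have be := norm_edgeAmp_le hr1 hs0 n j
  have mR := measurable_momAmp_sub_edgeAmp α β n j
  have bR := norm_momAmp_sub_edgeAmp_le hr1 hs0 n j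
  have per : Function.Periodic (fun k => ‖momAmp α β n j k - edgeAmp α β n j k‖)
      (2 * Real.pi) := fun k => by
    simp only [momAmp_periodic α β n j k, edgeAmp_periodic α β n j k]
  generalize momAmp α β n j = h at *
  generalize edgeAmp α β n j = e at *
  have ms : Measurable fun k : ℝ => k + τ := measurable_id.add_const τ
  have i1 : IntervalIntegrable (fun k => star (h k) * h (k + τ)) volume (-Real.pi) Real.pi :=
    Continuous.intervalIntegrable (by fun_prop) _ _
  have i2 : IntervalIntegrable (fun k => star (e k) * e (k + τ)) volume (-Real.pi) Real.pi := by
    refine intervalIntegrable_of_norm_le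
      ((Complex.continuous_conj.measurable.comp me).mul (me.comp ms)).stronglyMeasurable
      (C := 1) (fun k => ?_) _ _
    change ‖star (e k) * e (k + τ)‖ ≤ 1
    rw [norm_mul]
    exact mul_le_one₀ ((norm_star _).trans_le (be k)) (norm_nonneg _) (be _)
  have i3 : IntervalIntegrable (fun k => ‖h k - e k‖) volume (-Real.pi) Real.pi :=
    intervalIntegrable_of_norm_le mR.norm.stronglyMeasurable
      (C := 2) (fun k => by rw [norm_norm]; exact bR k) _ _
  have i4 : IntervalIntegrable (fun k => ‖h (k + τ) - e (k + τ)‖) volume (-Real.pi) Real.pi :=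
    intervalIntegrable_of_norm_le (mR.comp ms).norm.stronglyMeasurable
      (C := 2) (fun k => by rw [norm_norm]; exact bR (k + τ)) _ _
  have shift : ∫ k in -Real.pi..Real.pi, ‖h (k + τ) - e (k + τ)‖ =
      ∫ k in -Real.pi..Real.pi, ‖h k - e k‖ := by
    rw [intervalIntegral.integral_comp_add_right (fun k => ‖h k - e k‖) τ]
    have := per.intervalIntegral_add_eq (-Real.pi + τ) (-Real.pi)
    convert! this using 2 <;> ring
  rw [← intervalIntegral.integral_sub i1 i2, two_mul]
  nth_rewrite 2 [← shift]
  rw [← intervalIntegral.integral_add i3 i4]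
  refine intervalIntegral.norm_integral_le_of_norm_le (by linarith [Real.pi_pos])
    (Eventually.of_forall fun k _ => ?_) (i3.add i4)
  have e1 : star (h k) * h (k + τ) - star (e k) * e (k + τ) =
      star (h k - e k) * h (k + τ) + star (e k) * (h (k + τ) - e (k + τ)) := by
    rw [star_sub]
    ring
  rw [e1]
  refine (norm_add_le _ _).trans (add_le_add ?_ ?_)
  · rw [norm_mul, norm_star]
    exact mul_le_of_le_one_right (norm_nonneg _) (bh _)
  · rw [norm_mul, norm_star]
    exact mul_le_of_le_one_left (norm_nonneg _) (be _)

theorem sign_mul_abs_eq (x : ℝ) : (SignType.sign x : ℝ) * |x| = x := by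
  rcases lt_trichotomy x 0 with h | h | h
  · rw [sign_neg h, abs_of_neg h]; simp
  · simp [h]
  · rw [sign_pos h, abs_of_pos h]; simp

/-- The eigenvalue rotates with the group velocity. -/
theorem hasDerivAt_edgePhase (hr1 : |Real.sin (α - β)| < 1) (hs0 : Real.sin (α + β) ≠ 0)
    {k : ℝ} (hk : Real.cos k ≠ 0) :
    HasDerivAt (fun k => edgePhase (momB α β k))
      (Complex.I * edgeVel (Real.sin (α - β)) (Real.sin (α + β)) k * edgePhase (momB α β k)) k := by
  have hS := edgeCos_pos hr1 k
  set r := Real.sin (α - β) with hr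
  set s := Real.sin (α + β) with hs
  set σ : ℝ := (SignType.sign (-(s * Real.cos k)) : ℝ) with hσ
  have hne : -(s * Real.cos k) ≠ 0 := neg_ne_zero.2 (mul_ne_zero hs0 hk)
  have hσ2 : σ ^ 2 = 1 := sign_sq_eq_one hne
  -- The sign in the eigenvalue jumps only where cos vanishes, so it is constant near k and can be
  -- frozen before differentiating.
  have hev : (fun x => edgePhase (momB α β x)) =ᶠ[𝓝 k] fun x =>
      ((σ * edgeCos r x : ℝ) : ℂ) + ((-(r * Real.sin x) : ℝ) : ℂ) * Complex.I := by
    have hc : Continuous fun x => -(s * Real.cos x) := by fun_prop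
    have hsign : ∀ᶠ x in 𝓝 k, SignType.sign (-(s * Real.cos x)) =
        SignType.sign (-(s * Real.cos k)) := by
      rcases hne.lt_or_gt with h | h
      · filter_upwards [hc.continuousAt.eventually_lt continuousAt_const h] with x hx
        rw [sign_neg hx, sign_neg h]
      · filter_upwards [continuousAt_const.eventually_lt hc.continuousAt h] with x hx
        rw [sign_pos hx, sign_pos h]
    filter_upwards [hsign] with x hx
    rw [edgePhase_momB, ← hs, ← hr, hx]
  have hd : HasDerivAt (fun x =>
      ((σ * edgeCos r x : ℝ) : ℂ) + ((-(r * Real.sin x) : ℝ) : ℂ) * Complex.I)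
      (((σ * (-(r ^ 2 * (Real.sin k * Real.cos k)) / edgeCos r k) : ℝ) : ℂ) +
        ((-(r * Real.cos k) : ℝ) : ℂ) * Complex.I) k :=
    ((hasDerivAt_edgeCos hr1 k).const_mul σ).ofReal_comp.add
      ((((Real.hasDerivAt_sin k).const_mul r).neg.ofReal_comp).mul_const Complex.I)
  refine (hd.congr_of_eventuallyEq hev).congr_deriv ?_
  have hv : edgeVel r s k = -(σ * r * Real.cos k / edgeCos r k) := by
    have h1 : (SignType.sign (s * r) : ℝ) * |r| = (SignType.sign s : ℝ) * r := by
      rw [sign_mul, SignType.coe_mul, mul_assoc, sign_mul_abs_eq]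
    have h2 : σ * Real.cos k = -((SignType.sign s : ℝ) * |Real.cos k|) := by
      have hcos := sign_mul_abs_eq (Real.cos k)
      have hcs := sign_sq_eq_one hk
      rw [hσ, Left.sign_neg, sign_mul, SignType.coe_neg, SignType.coe_mul]
      linear_combination (-(SignType.sign s : ℝ)) * (SignType.sign (Real.cos k) : ℝ) * hcos.symm
        - (SignType.sign s : ℝ) * |Real.cos k| * hcs
    rw [edgeVel, ← mul_div_assoc, ← mul_assoc, h1, ← neg_div]
    congr 1
    linear_combination r * h2
  have hphase : edgePhase (momB α β k) =
      ((σ * edgeCos r k : ℝ) : ℂ) + ((-(r * Real.sin k) : ℝ) : ℂ) * Complex.I := hev.self_of_nhds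
  have hσc : (σ : ℂ) ^ 2 = 1 := by exact_mod_cast hσ2
  have hSc : (edgeCos r k : ℂ) ≠ 0 := by exact_mod_cast hS.ne'
  rw [hphase, hv]
  generalize Real.sin k = x
  generalize Real.cos k = y
  push_cast
  field_simp
  linear_combination (r * y : ℂ) * ((-(σ * r * x)) * Complex.I_sq + Complex.I * edgeCos r k * hσc)

/-- As λ(k) has modulus one, conj λ(k) λ(k + t/n) = 1 + z_n with n z_n → t conj λ(k) λ'(k) = i t
v(k), and (1 + z_n)ⁿ → exp(i t v(k)). -/
theorem tendsto_edgePhase_pow (hr1 : |Real.sin (α - β)| < 1) (hs0 : Real.sin (α + β) ≠ 0)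
    {k : ℝ} (hk : Real.cos k ≠ 0) (t : ℝ) :
    Tendsto (fun n : ℕ => star (edgePhase (momB α β k)) ^ n *
      edgePhase (momB α β (k + t / n)) ^ n) atTop
      (𝓝 (Complex.exp (t * edgeVel (Real.sin (α - β)) (Real.sin (α + β)) k * Complex.I))) := by
  have hd := hasDerivAt_edgePhase hr1 hs0 hk
  have hn := norm_edgePhase_momB hr1 hs0 hk
  set v := edgeVel (Real.sin (α - β)) (Real.sin (α + β)) k
  set l := fun k => edgePhase (momB α β k) with hl
  change Tendsto (fun n : ℕ => star (l k) ^ n * l (k + t / n) ^ n) atTop _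
  change ‖l k‖ = 1 at hn
  have hll : star (l k) * l k = 1 := by
    rw [mul_comm, Complex.star_def, Complex.mul_conj, Complex.normSq_eq_norm_sq, hn]
    simp
  have hd' : HasDerivAt (fun u : ℝ => l (k + t * u)) (t • (Complex.I * v * l k)) 0 := by
    have h1 : HasDerivAt (fun u : ℝ => k + t * u) t 0 := by
      simpa using ((hasDerivAt_id (0 : ℝ)).const_mul t).const_add k
    have h2 : HasDerivAt l (Complex.I * v * l k) (k + t * 0) := by simpa using hd
    exact h2.scomp (0 : ℝ) h1
  have hu : Tendsto (fun n : ℕ => ((n : ℝ))⁻¹) atTop (𝓝[≠] 0) := by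
    rw [tendsto_nhdsWithin_iff]
    refine ⟨tendsto_inv_atTop_nhds_zero_nat, ?_⟩
    filter_upwards [eventually_ne_atTop 0] with n hn
    exact inv_ne_zero (by exact_mod_cast hn)
  have hslope := (hasDerivAt_iff_tendsto_slope_zero.1 hd').comp hu
  have hg := Complex.tendsto_one_add_pow_exp_of_tendsto
    (g := fun n : ℕ => star (l k) * (l (k + t / n) - l k)) (t := t * v * Complex.I) (by
      have := hslope.const_mul (star (l k))
      convert! this using 1
      · funext n
        simp [div_eq_mul_inv]
        ring
      · congr 1
        rw [Complex.real_smul]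
        linear_combination (-(t * v * Complex.I : ℂ)) * hll)
  refine hg.congr fun n => ?_
  rw [← mul_pow]
  congr 1
  linear_combination (-1 : ℂ) * hll

theorem continuousAt_edgeWeight_mul (hr1 : |Real.sin (α - β)| < 1) (hs0 : Real.sin (α + β) ≠ 0)
    {k : ℝ} (hk : Real.cos k ≠ 0) (hk' : Real.sin k ≠ 0) (p : ℕ) :
    ContinuousAt (fun k => (edgeWeight (momB α β k) : ℂ) *
      edgeDecay (momA α β k) (momB α β k) ^ p) k := by
  have hA : Continuous (momA α β) := by
    simp only [funext (momA_eq α β)]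
    fun_prop
  have hB : Continuous (momB α β) := by
    simp only [funext (momB_eq α β)]
    fun_prop
  have hW : Continuous fun k => edgeWeight (momB α β k) := by
    simp only [edgeWeight_momB]
    exact continuous_edgeOverlap hr1 _
  have hP := (hasDerivAt_edgePhase hr1 hs0 hk).continuousAt
  exact (Complex.continuous_ofReal.comp hW).continuousAt.mul
    (((hP.sub hB.continuousAt).div hA.continuousAt (momA_ne_zero hr1 hk')).pow p)

theorem tendsto_edgeAmp_mul (hr1 : |Real.sin (α - β)| < 1) (hs0 : Real.sin (α + β) ≠ 0)
    {k : ℝ} (hk : Real.cos k ≠ 0) (hk' : Real.sin k ≠ 0) (j : ℕ) (t : ℝ) :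
    Tendsto (fun n : ℕ => star (edgeAmp α β n j k) * edgeAmp α β n j (k + t / n)) atTop
      (𝓝 (edgeProb (Real.sin (α - β)) (Real.sin (α + β)) j k •
        Complex.exp (t * edgeVel (Real.sin (α - β)) (Real.sin (α + β)) k * Complex.I))) := by
  have hc := continuousAt_edgeWeight_mul hr1 hs0 hk hk' ⌈(j : ℝ) / 2⌉₊
  set c : ℝ → ℂ := fun k => (edgeWeight (momB α β k) : ℂ) *
      edgeDecay (momA α β k) (momB α β k) ^ ⌈(j : ℝ) / 2⌉₊ with hcdef
  have hk0 : Tendsto (fun n : ℕ => k + t / n) atTop (𝓝 k) := by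
    simpa using (tendsto_const_div_atTop_nhds_zero_nat t).const_add k
  have h1 := ((hc.tendsto.comp hk0).const_mul (star (c k))).mul (tendsto_edgePhase_pow hr1 hs0 hk t)
  have hcc : star (c k) * c k =
      (edgeProb (Real.sin (α - β)) (Real.sin (α + β)) j k : ℂ) := by
    rw [mul_comm, Complex.star_def, Complex.mul_conj, hcdef, map_mul, map_pow,
      normSq_edgeDecay hr1 hs0 hk (momA_ne_zero hr1 hk'), Complex.normSq_ofReal, edgeWeight_momB,
      edgeProb, sq]
  rw [hcc] at h1
  rw [Complex.real_smul]
  refine h1.congr fun n => ?_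
  simp only [Function.comp, edgeAmp, hcdef, star_mul', star_pow]
  ring

theorem tendsto_integral_edgeAmp (hr1 : |Real.sin (α - β)| < 1) (hs0 : Real.sin (α + β) ≠ 0)
    (j : ℕ) (t : ℝ) :
    Tendsto (fun n : ℕ => ∫ k in -Real.pi..Real.pi,
      star (edgeAmp α β n j k) * edgeAmp α β n j (k + t / n)) atTop
      (𝓝 (∫ k in -Real.pi..Real.pi, edgeProb (Real.sin (α - β)) (Real.sin (α + β)) j k •
        Complex.exp (t * edgeVel (Real.sin (α - β)) (Real.sin (α + β)) k * Complex.I))) := by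
  refine intervalIntegral.tendsto_integral_filter_of_dominated_convergence (fun _ => 1)
    (Eventually.of_forall fun n => ?_)
    (Eventually.of_forall fun n => Eventually.of_forall fun k _ => ?_)
    intervalIntegrable_const ?_
  · have me := measurable_edgeAmp α β n j
    exact ((Complex.continuous_conj.measurable.comp me).mul
      (me.comp (measurable_id.add_const (t / n)))).aestronglyMeasurable
  · rw [norm_mul, norm_star]
    exact mul_le_one₀ (norm_edgeAmp_le hr1 hs0 n j k) (norm_nonneg _)
      (norm_edgeAmp_le hr1 hs0 n j _)
  · filter_upwards [ae_cos_ne_zero_and_sin_ne_zero] with k hk _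
    exact tendsto_edgeAmp_mul hr1 hs0 hk.1 hk.2 j t

/-- Convergence of the characteristic functions of the finding probabilities. -/
theorem tendsto_sum_nu_mul_exp (hr0 : 0 < |Real.sin (α - β)|) (hr1 : |Real.sin (α - β)| < 1)
    (hs0 : Real.sin (α + β) ≠ 0) (j : ℕ) (t : ℝ) :
    Tendsto (fun n : ℕ => ∑ m ∈ Finset.Icc (-n : ℤ) n,
      (nu α β n j m : ℂ) * Complex.exp (t * ((m / n : ℝ) : ℂ) * Complex.I)) atTop
      (𝓝 (∫ y, g (Real.sin (α - β)) (Real.sin (α + β)) j y • Complex.exp (t * y * Complex.I))) := by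
  rw [integral_g_smul_eq_circle hr0 hr1 hs0 j (F := fun y => Complex.exp (t * y * Complex.I))
    (by fun_prop)]
  have hdiff : Tendsto (fun n : ℕ =>
      (∫ k in -Real.pi..Real.pi, star (momAmp α β n j k) * momAmp α β n j (k + t / n)) -
      ∫ k in -Real.pi..Real.pi, star (edgeAmp α β n j k) * edgeAmp α β n j (k + t / n))
      atTop (𝓝 0) := by
    refine squeeze_zero_norm (fun n =>
      norm_integral_momAmp_sub_integral_edgeAmp_le hr1 hs0 n j (t / n)) ?_
    simpa using (tendsto_integral_norm_momAmp_sub_edgeAmp hr1 hs0 j).const_mul 2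
  have h := (hdiff.add (tendsto_integral_edgeAmp hr1 hs0 j t)).const_smul (2 * Real.pi)⁻¹
  rw [zero_add] at h
  refine h.congr fun n => ?_
  rw [sub_add_cancel, ← sum_nu_mul_exp, Complex.real_smul, ← mul_assoc]
  have hpi : (Real.pi : ℂ) ≠ 0 := by exact_mod_cast Real.pi_ne_zero
  rw [show (((2 * Real.pi)⁻¹ : ℝ) : ℂ) * (2 * Real.pi) = 1 by push_cast; field_simp, one_mul]
  refine Finset.sum_congr rfl fun m _ => ?_
  congr 2
  push_cast
  ring

end

/-! ### Weak convergence -/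

section

variable {α β : ℝ}

/-- The rescaled finding probabilities, completed to a probability measure by an atom at `c`. -/
def walkMeasure (α β : ℝ) (j : ℕ) (c : ℝ) (n : ℕ) : Measure ℝ :=
  (∑ m ∈ Finset.Icc (-n : ℤ) n, ENNReal.ofReal (nu α β n j m) • Measure.dirac ((m : ℝ) / n)) +
    ENNReal.ofReal (1 - ∑ m ∈ Finset.Icc (-n : ℤ) n, nu α β n j m) • Measure.dirac c

/-- The measure with density `g`, completed to a probability measure by an atom at `c`. -/
def limitMeasure (r s : ℝ) (j : ℕ) (c : ℝ) : Measure ℝ :=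
  volume.withDensity (fun y => ENNReal.ofReal (g r s j y)) +
    ENNReal.ofReal (1 - ∫ y, g r s j y) • Measure.dirac c

theorem nu_nonneg (α β : ℝ) (n j : ℕ) (m : ℤ) : 0 ≤ nu α β n j m := sq_nonneg _

theorem isProbabilityMeasure_walkMeasure (α β : ℝ) (j : ℕ) (c : ℝ) (n : ℕ) :
    IsProbabilityMeasure (walkMeasure α β j c n) := by
  constructor
  have h0 : 0 ≤ ∑ m ∈ Finset.Icc (-n : ℤ) n, nu α β n j m :=
    Finset.sum_nonneg fun m _ => nu_nonneg α β n j m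
  have h1 := sum_nu_le_one α β n j
  simp only [walkMeasure, Measure.coe_add, Measure.coe_finsetSum, Pi.add_apply, Finset.sum_apply,
    Measure.smul_apply, measure_univ, smul_eq_mul, mul_one]
  rw [← ENNReal.ofReal_sum_of_nonneg fun m _ => nu_nonneg α β n j m,
    ← ENNReal.ofReal_add h0 (by linarith), add_sub_cancel, ENNReal.ofReal_one]

theorem lintegral_g {r s : ℝ} (hr0 : 0 < |r|) (hr1 : |r| < 1) (hs0 : s ≠ 0) (hs1 : |s| ≤ 1)
    (j : ℕ) : ∫⁻ y, ENNReal.ofReal (g r s j y) = ENNReal.ofReal (∫ y, g r s j y) :=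
  (ofReal_integral_eq_lintegral_ofReal (integrable_g hr0 hr1 hs0 j)
    (Eventually.of_forall fun y => g_nonneg hr1 hs1 j y)).symm

theorem integral_g_le_one {r s : ℝ} (hr0 : 0 < |r|) (hr1 : |r| < 1) (hs0 : s ≠ 0) (hs1 : |s| ≤ 1)
    (j : ℕ) : ∫ y, g r s j y ≤ 1 :=
  (Finset.single_le_sum (f := fun j => ∫ y, g r s j y)
    (fun j _ => integral_nonneg (g_nonneg hr1 hs1 j)) (Finset.self_mem_range_succ j)).trans
    (sum_integral_g_le hr0 hr1 hs0 hs1 (j + 1))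

theorem isProbabilityMeasure_limitMeasure {r s : ℝ} (hr0 : 0 < |r|) (hr1 : |r| < 1) (hs0 : s ≠ 0)
    (hs1 : |s| ≤ 1) (j : ℕ) (c : ℝ) : IsProbabilityMeasure (limitMeasure r s j c) := by
  constructor
  have h0 : 0 ≤ ∫ y, g r s j y := integral_nonneg (g_nonneg hr1 hs1 j)
  have h1 := integral_g_le_one hr0 hr1 hs0 hs1 j
  rw [limitMeasure, Measure.add_apply, withDensity_apply _ MeasurableSet.univ,
    Measure.restrict_univ, Measure.smul_apply, measure_univ, smul_eq_mul, mul_one, lintegral_g hr0 hr1 hs0 hs1,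
    ← ENNReal.ofReal_add h0 (by linarith), add_sub_cancel, ENNReal.ofReal_one]

theorem integral_walkMeasure {E : Type*} [NormedAddCommGroup E] [NormedSpace ℝ E]
    [CompleteSpace E] (α β : ℝ) (j : ℕ) (c : ℝ) (n : ℕ) (F : ℝ → E) :
    ∫ y, F y ∂(walkMeasure α β j c n) =
      (∑ m ∈ Finset.Icc (-n : ℤ) n, nu α β n j m • F ((m : ℝ) / n)) +
        (1 - ∑ m ∈ Finset.Icc (-n : ℤ) n, nu α β n j m) • F c := by
  have hd : ∀ (w x : ℝ), Integrable F (ENNReal.ofReal w • Measure.dirac x) := fun w x =>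
    (integrable_dirac (by simp)).smul_measure ENNReal.ofReal_ne_top
  rw [walkMeasure, integral_add_measure (integrable_finsetSum_measure.2 fun m _ => hd _ _) (hd _ _),
    integral_finsetSum_measure fun m _ => hd _ _]
  simp only [integral_smul_measure, integral_dirac]
  rw [ENNReal.toReal_ofReal (by linarith [sum_nu_le_one α β n j])]
  congr 1
  exact Finset.sum_congr rfl fun m _ => by rw [ENNReal.toReal_ofReal (nu_nonneg α β n j m)]

theorem integral_limitMeasure {E : Type*} [NormedAddCommGroup E] [NormedSpace ℝ E]
    [CompleteSpace E] {r s : ℝ} (hr0 : 0 < |r|) (hr1 : |r| < 1) (hs0 : s ≠ 0) (hs1 : |s| ≤ 1)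
    (j : ℕ) (c : ℝ) {F : ℝ → E} (hF : StronglyMeasurable F) {C : ℝ} (hC : ∀ y, ‖F y‖ ≤ C) :
    ∫ y, F y ∂(limitMeasure r s j c) =
      (∫ y, g r s j y • F y) + (1 - ∫ y, g r s j y) • F c := by
  have hm : AEMeasurable (fun y => ENNReal.ofReal (g r s j y)) volume :=
    (integrable_g hr0 hr1 hs0 j).aestronglyMeasurable.aemeasurable.ennreal_ofReal
  have := isProbabilityMeasure_limitMeasure hr0 hr1 hs0 hs1 j c
  have hi : Integrable F (limitMeasure r s j c) :=
    Integrable.of_bound hF.aestronglyMeasurable C (Eventually.of_forall hC)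
  rw [limitMeasure] at hi ⊢
  rw [integral_add_measure hi.left_of_add_measure hi.right_of_add_measure, integral_smul_measure,
    integral_dirac, ENNReal.toReal_ofReal (by linarith [integral_g_le_one hr0 hr1 hs0 hs1 j]),
    integral_withDensity_eq_integral_toReal_smul₀ hm (Eventually.of_forall fun y =>
      ENNReal.ofReal_lt_top)]
  congr 1
  refine integral_congr_ae (Eventually.of_forall fun y => ?_)
  simp only [ENNReal.toReal_ofReal (g_nonneg hr1 hs1 j y)]

theorem tendsto_sum_nu (hr0 : 0 < |Real.sin (α - β)|) (hr1 : |Real.sin (α - β)| < 1)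
    (hs0 : Real.sin (α + β) ≠ 0) (j : ℕ) :
    Tendsto (fun n : ℕ => ∑ m ∈ Finset.Icc (-n : ℤ) n, nu α β n j m) atTop
      (𝓝 (∫ y, g (Real.sin (α - β)) (Real.sin (α + β)) j y)) := by
  have h := tendsto_sum_nu_mul_exp hr0 hr1 hs0 j 0
  simp only [Complex.ofReal_zero, zero_mul, Complex.exp_zero, mul_one, Complex.real_smul] at h
  rw [integral_complex_ofReal] at h
  simpa [Function.comp_def] using (Complex.continuous_re.tendsto _).comp h

/-- `walkMeasure` as a bundled probability measure. -/
def walkLaw (α β : ℝ) (j : ℕ) (c : ℝ) (n : ℕ) : ProbabilityMeasure ℝ :=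
  ⟨walkMeasure α β j c n, isProbabilityMeasure_walkMeasure α β j c n⟩

theorem coe_walkLaw (α β : ℝ) (j : ℕ) (c : ℝ) (n : ℕ) :
    (walkLaw α β j c n : Measure ℝ) = walkMeasure α β j c n := rfl

/-- `limitMeasure` as a bundled probability measure. -/
def limitLaw {r s : ℝ} (hr0 : 0 < |r|) (hr1 : |r| < 1) (hs0 : s ≠ 0) (hs1 : |s| ≤ 1)
    (j : ℕ) (c : ℝ) : ProbabilityMeasure ℝ :=
  ⟨limitMeasure r s j c, isProbabilityMeasure_limitMeasure hr0 hr1 hs0 hs1 j c⟩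

theorem coe_limitLaw {r s : ℝ} (hr0 : 0 < |r|) (hr1 : |r| < 1) (hs0 : s ≠ 0) (hs1 : |s| ≤ 1)
    (j : ℕ) (c : ℝ) :
    (limitLaw hr0 hr1 hs0 hs1 j c : Measure ℝ) = limitMeasure r s j c := rfl

/-- Lévy's continuity theorem. The weight of the added atom converges too, since the total mass is
the characteristic function at t = 0. -/
theorem tendsto_walkLaw (hr0 : 0 < |Real.sin (α - β)|) (hr1 : |Real.sin (α - β)| < 1)
    (hs0 : Real.sin (α + β) ≠ 0) (j : ℕ) (c : ℝ) :
    Tendsto (walkLaw α β j c) atTop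
      (𝓝 (limitLaw hr0 hr1 hs0 (Real.abs_sin_le_one (α + β)) j c)) := by
  rw [ProbabilityMeasure.tendsto_iff_tendsto_charFun]
  intro t
  simp only [coe_walkLaw, coe_limitLaw, charFun_apply_real]
  rw [integral_limitMeasure hr0 hr1 hs0 (Real.abs_sin_le_one _) j c (C := 1)
    (F := fun y : ℝ => Complex.exp (t * y * Complex.I))
    (by fun_prop : Continuous fun y : ℝ => Complex.exp (t * y * Complex.I)).stronglyMeasurable
    (fun y => by
      rw [← Complex.ofReal_mul, Complex.norm_exp_ofReal_mul_I])]
  simp only [integral_walkMeasure]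
  refine Tendsto.add ?_ (((tendsto_sum_nu hr0 hr1 hs0 j).const_sub 1).smul_const _)
  simpa only [Complex.real_smul] using tendsto_sum_nu_mul_exp hr0 hr1 hs0 j t

theorem tendsto_tsum_nu_mul (hr0 : 0 < |Real.sin (α - β)|) (hr1 : |Real.sin (α - β)| < 1)
    (hs0 : Real.sin (α + β) ≠ 0) (j : ℕ) (f : ℝ →ᵇ ℝ) :
    Tendsto (fun n : ℕ => ∑' m : ℤ, nu α β n j m * f ((m : ℝ) / n)) atTop
      (𝓝 (∫ y, f y * g (Real.sin (α - β)) (Real.sin (α + β)) j y)) := by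
  -- The position of the atom is immaterial here, as its contribution is subtracted again; 0 is
  -- used.
  have h := ProbabilityMeasure.tendsto_iff_forall_integral_tendsto.1
    (tendsto_walkLaw hr0 hr1 hs0 j 0) f
  simp only [coe_walkLaw, coe_limitLaw, integral_walkMeasure] at h
  rw [integral_limitMeasure hr0 hr1 hs0 (Real.abs_sin_le_one _) j 0
    f.continuous.stronglyMeasurable f.norm_coe_le_norm] at h
  have h' := h.sub (((tendsto_sum_nu hr0 hr1 hs0 j).const_sub 1).smul_const (f 0))
  simp only [add_sub_cancel_right, smul_eq_mul] at h'
  simp only [mul_comm (f _)]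
  refine h'.congr fun n => ?_
  exact (tsum_eq_sum fun m hm => by rw [nu_eq_zero α β n j hm, zero_mul]).symm

theorem tendsto_tsum_nu_Ioo (hr0 : 0 < |Real.sin (α - β)|) (hr1 : |Real.sin (α - β)| < 1)
    (hs0 : Real.sin (α + β) ≠ 0) (j : ℕ) {a b : ℝ} (hab : a < b) :
    Tendsto (fun n : ℕ => ∑' m : {m : ℤ // a < (m : ℝ) / n ∧ (m : ℝ) / n < b}, nu α β n j m)
      atTop (𝓝 (∫ y in a..b, g (Real.sin (α - β)) (Real.sin (α + β)) j y)) := by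
  -- The atom is placed at b + 1, outside [a, b], so that it charges neither the interval nor its
  -- endpoints.
  have hlim := tendsto_walkLaw hr0 hr1 hs0 j (b + 1)
  have hs1 := Real.abs_sin_le_one (α + β)
  set r := Real.sin (α - β)
  set s := Real.sin (α + β)
  have hfr : limitMeasure r s j (b + 1) (frontier (Ioo a b)) = 0 := by
    have hnull : volume ({a, b} : Set ℝ) = 0 := (Set.toFinite _).measure_zero _
    rw [frontier_Ioo hab, limitMeasure, Measure.add_apply, Measure.smul_apply,
      withDensity_absolutelyContinuous _ _ hnull, Measure.dirac_apply' _ (by measurability),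
      indicator_of_notMem]
    · simp
    · simp only [mem_insert_iff, mem_singleton_iff, not_or]
      constructor <;> linarith
  have h := ProbabilityMeasure.tendsto_measure_of_null_frontier_of_tendsto' hlim hfr
  simp only [coe_walkLaw, coe_limitLaw] at h
  have htop : limitMeasure r s j (b + 1) (Ioo a b) ≠ ⊤ := by
    have := isProbabilityMeasure_limitMeasure hr0 hr1 hs0 hs1 j (b + 1)
    exact measure_ne_top _ _
  have hreal := (ENNReal.tendsto_toReal htop).comp h
  have hc : b + 1 ∉ Ioo a b := fun h => by linarith [h.2]
  have hval : (limitMeasure r s j (b + 1) (Ioo a b)).toReal = ∫ y in a..b, g r s j y := by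
    rw [limitMeasure, Measure.add_apply, Measure.smul_apply, Measure.dirac_apply' _ measurableSet_Ioo,
      indicator_of_notMem hc, smul_zero, add_zero, withDensity_apply _ measurableSet_Ioo,
      ← ofReal_integral_eq_lintegral_ofReal (integrable_g hr0 hr1 hs0 j).integrableOn
        (Eventually.of_forall fun y => g_nonneg hr1 hs1 j y),
      ENNReal.toReal_ofReal (integral_nonneg (g_nonneg hr1 hs1 j)),
      intervalIntegral.integral_of_le hab.le, integral_Ioc_eq_integral_Ioo]
  rw [← hval]
  refine hreal.congr fun n => ?_
  simp only [Function.comp]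
  have hn := integral_walkMeasure α β j (b + 1) n ((Ioo a b).indicator (1 : ℝ → ℝ))
  rw [integral_indicator_one measurableSet_Ioo, indicator_of_notMem hc, smul_zero, add_zero] at hn
  rw [← measureReal_def, hn]
  have hsub : ∑' m : {m : ℤ // a < (m : ℝ) / n ∧ (m : ℝ) / n < b}, nu α β n j m =
      ∑' m : ℤ, {m : ℤ | a < (m : ℝ) / n ∧ (m : ℝ) / n < b}.indicator (nu α β n j) m :=
    tsum_subtype {m : ℤ | a < (m : ℝ) / n ∧ (m : ℝ) / n < b} (nu α β n j)
  rw [hsub, tsum_eq_sum (s := Finset.Icc (-n : ℤ) n) fun m hm => by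
    rw [indicator_apply, nu_eq_zero α β n j hm, ite_self]]
  refine Finset.sum_congr rfl fun m _ => ?_
  by_cases hm : a < (m : ℝ) / n ∧ (m : ℝ) / n < b
  · rw [indicator_of_mem (show (m : ℝ) / n ∈ Ioo a b from hm),
      indicator_of_mem (show m ∈ {m : ℤ | a < (m : ℝ) / n ∧ (m : ℝ) / n < b} from hm)]
    simp
  · rw [indicator_of_notMem (show (m : ℝ) / n ∉ Ioo a b from hm),
      indicator_of_notMem (show m ∉ {m : ℤ | a < (m : ℝ) / n ∧ (m : ℝ) / n < b} from hm)]
    simp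

end

end AEModel

end

theorem theorem4 (α β r s : ℝ)
    (hr : r = Real.sin (α - β)) (hs : s = Real.sin (α + β))
    (hr0 : 0 < |r|) (hr1 : |r| < 1) (hs0 : s ≠ 0) :
    -- `g` is the density of a sub-probability measure on `ℤ₊ × ℝ`
    (∀ j y, 0 ≤ AEModel.g r s j y) ∧
    (∀ j, Integrable (AEModel.g r s j)) ∧
    ((∑' j : ℕ, (∫⁻ y, ENNReal.ofReal (AEModel.g r s j y))) ≤ 1) ∧
    -- convergence of the probabilities of intervals
    (∀ (j : ℕ) (a b : ℝ), a < b →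
      Tendsto
        (fun n : ℕ => ∑' m : {m : ℤ // a < (m : ℝ) / n ∧ (m : ℝ) / n < b}, AEModel.nu α β n j m)
        atTop (𝓝 (∫ y in a..b, AEModel.g r s j y))) ∧
    -- weak convergence, tested against bounded continuous functions
    (∀ (j : ℕ) (f : ℝ →ᵇ ℝ),
      Tendsto (fun n : ℕ => ∑' m : ℤ, AEModel.nu α β n j m * f ((m : ℝ) / n))
        atTop (𝓝 (∫ y, f y * AEModel.g r s j y))) ∧
    -- exponential decay of the density in `j`
    (∀ y, 0 < |y| → |y| < |r| → 0 < AEModel.zeta r s y ∧ AEModel.zeta r s y < 1) ∧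
    (∀ j y, AEModel.g r s j y = AEModel.zeta r s y ^ ⌈(j : ℝ) / 2⌉₊ * AEModel.g r s 0 y) := by
  subst hr hs
  have hs1 := Real.abs_sin_le_one (α + β)
  exact ⟨fun j y => AEModel.g_nonneg hr1 hs1 j y, fun j => AEModel.integrable_g hr0 hr1 hs0 j,
    AEModel.tsum_lintegral_g_le hr0 hr1 hs0 hs1,
    fun j a b hab => AEModel.tendsto_tsum_nu_Ioo hr0 hr1 hs0 j hab,
    fun j f => AEModel.tendsto_tsum_nu_mul hr0 hr1 hs0 j f,
    fun y hy0 hy => AEModel.zeta_mem_Ioo hs0 hs1 hy0 hy,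
    fun j y => AEModel.g_eq_zeta_pow_mul _ _ j y⟩
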